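/- **Setting.** A (finite-horizon) Dec-POMDP $D$ consists of agents $\mathcal N=\{1,\dots,N\}$, a finite set $\mathcal S$ of states, finite sets $\mathcal A_i$, $\mathcal O_i$ of actions and observations of agent $i$ (with $\mathcal A=\prod_i\mathcal A_i$, $\mathcal O=\prod_i\mathcal O_i$), transition probabilities $P(s'\mid s,a)$, a reward $\mathcal R(s,a)\in\mathbb R$, observation probabilities $O(o\mid s,a)$, an initial distribution $b_0$ on $\mathcal S$ and a horizon $T$. At each step $t=0,\dots,T$, agent $i$ draws $A_{i,t}\sim\pi_i(\cdot\mid\tau_{i,t})$, where $\tau_{i,t}=(A_{i,0},O_{i,1},\dots,A_{i,t-1},O_{i,t})$ is its action-observation history; then $S_{t+1}\sim P(\cdot\mid S_t,A_t)$ and $O_{t+1}\sim O(\cdot\mid S_{t+1},A_t)$. Let $\Pi^D$ be the set of joint (stochastic) policies $\pi=(\pi_i)_i$ with its Borel $\sigma$-algebra, $\Delta(\Pi^D)$ the set of probability measures on it, and $J^D(\pi)=\mathbb E_\pi\big[\sum_{t=0}^T\mathcal R(S_t,A_t)\big]$. An isomorphism $f\in\mathrm{Iso}(D,E)$ of Dec-POMDPs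 with equal horizons is a tuple of bijections $f_N:\mathcal N^D\to\mathcal N^E$, $f_S:\mathcal S^D\to\mathcal S^E$, $f_{A_i}:\mathcal A_i^D\to\mathcal A^E_{f_N(i)}$, $f_{O_i}:\mathcal O_i^D\to\mathcal O^E_{f_N(i)}$ that preserves $P,O,\mathcal R,b_0$; $\mathrm{Aut}(D)=\mathrm{Iso}(D,D)$. The pushforward $f^*\pi\in\Pi^E$ is $(f^*\pi)_j(a\mid\tau)=\pi_{f^{-1}j}(f^{-1}a\mid f^{-1}\tau)$. For $g\in\mathrm{Aut}(D)^{\mathcal N}$ let $(g^*\pi)_i=(g_i^*\pi)_i$. The other-play (OP) value of $\pi$ is $J^D_{\mathrm{OP}}(\pi)=\mathbb E_{g}[J^D(g^*\pi)]$ with $g$ uniform on $\mathrm{Aut}(D)^{\mathcal N}$, and $\pi$ is OP-optimal if it maximizes $J^D_{\mathrm{OP}}$ over $\Pi^D$. Let $\mu$ be the law of $g^*\pi$, and $\mu_i$ its marginals. The symmetrizer $\Psi^D(\pi)$ is the joint policy for which $\Psi^D(\pi)_i(a\mid\tau)$ is the conditional probability that agent $i$ plays $a$ given that its history is $\tau$,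 when its local policy is drawn at the start from $\mu_i$ and those of the other agents independently from any distributions under which $\tau$ has positive probability ($1/|\mathcal A_i|$ if there are none). Write $[\pi]=\{\pi':\Psi^D(\pi')=\Psi^D(\pi)\}$ and $f^*[\pi]=[f^*\pi]$ for $f\in\mathrm{Iso}(D,E)$. A labeling of $D$ is a tuple of bijections from $\mathcal N,\mathcal S,\mathcal A_i,\mathcal O_i$ onto $\{1,\dots,k\}$ with the respective $k$; transporting $D$ along it gives a relabeled problem, and $\mathcal D$ is the (finite) set of all relabeled problems of $D$. A learning algorithm $\sigma$ assigns to each $E\in\mathcal D$ some $\sigma(E)\in\Delta(\Pi^E)$. It is an OP learning algorithm if $\mathbb E_{\pi\sim\sigma(E)}[J^E_{\mathrm{OP}}(\pi)]=\max_{\Pi^E}J^E_{\mathrm{OP}}$ for all $E\in\mathcal D$. Its value in the label-free coordination (LFC) problem for $D$ is $$U^D(\sigma)=\mathbb E\big[J^D\big((\pi^{(k)}_k)_{k\in\mathcal N}\big)\big],$$ where, independently for $k\in\mathcal N$, $D_k$ is uniform on $\mathcal D$, $f_k$ is uniform on $\mathrm{Iso}(D_k,D)$, and $\pi^{(k)}=f_k^*\rho$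 with $\rho\sim\sigma(D_k)$; $\sigma$ is optimal in the LFC problem if it maximizes $U^D$ over all learning algorithms. **The game.** From now on $D$ is the two-stage lever game: two agents, one state, $\mathcal A_i=\mathcal O_i=\{1,2\}$, $T=1$ (two rounds), reward $1$ if both agents pull the same lever and $-1$ otherwise, and in the second round each agent observes the other agent's first action. In both policies $\pi^R$ and $\pi^S$ each agent chooses uniformly in the first round, and also in the second round if the first actions differed; if the first actions agreed, each agent repeats its action under $\pi^R$ and switches to the other action under $\pi^S$. For each $E\in\mathcal D$ fix any $f_{D,E}\in\mathrm{Iso}(D,E)$. Say that $\sigma$ *learns both $[\pi^R]$ and $[\pi^S]$* if for every $E\in\mathcal D$ there are $\alpha_E\in[0,1]$ and $\mu^E,\mu'^E\in\Delta(\Pi^E)$ with $\sigma(E)=\alpha_E\mu^E+(1-\alpha_E)\mu'^E$ and $\mu^E(f_{D,E}^*[\pi^R])=1=\mu'^E(f_{D,E}^*[\pi^S])$, such that $\alpha_{E}>0$ for some $E\in\mathcal D$ and $\alpha_{E'}<1$ for some (possibly different) $E'\in\mathcal D$. **Theorem.** (1) The OP-optimal policies of the two-stage lever game form exactly two classes: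 $[\pi^R]\neq[\pi^S]$, a policy is OP-optimal if and only if it lies in $[\pi^R]\cup[\pi^S]$, and all these policies have OP value $\tfrac12$. (2) $J^D(\pi^R_1,\pi^S_2)=J^D(\pi^S_1,\pi^R_2)=-\tfrac12$. (3) Every learning algorithm $\sigma$ that learns both $[\pi^R]$ and $[\pi^S]$ is an OP learning algorithm, satisfies $U^D(\sigma)<\tfrac12$, and is not optimal in the LFC problem for $D$. -/

import Mathlib

open MeasureTheory
open scoped BigOperators

noncomputable section

/-- Finite-horizon decentralized partially observable Markov decision problem, with agents
`Fin N`, finite sets of states, of actions and of observations, and horizon `T`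
(the time steps are `0, …, T`). Probability distributions on a finite set `X` are points of
`stdSimplex ℝ X`. -/
structure DecPOMDP : Type 1 where
  N : ℕ
  State : Type
  Act : Fin N → Type
  Obs : Fin N → Type
  [fintypeState : Fintype State]
  [fintypeAct : ∀ i, Fintype (Act i)]
  [fintypeObs : ∀ i, Fintype (Obs i)]
  /-- `trans s a s'` is the probability `P(s' ∣ s, a)`. -/
  trans : State → (∀ i, Act i) → stdSimplex ℝ State
  reward : State → (∀ i, Act i) → ℝ
  /-- `obsKer s a o` is the probability `O(o ∣ s, a)` of the joint observation `o` in the new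
  state `s` after the joint action `a`. -/
  obsKer : State → (∀ i, Act i) → stdSimplex ℝ (∀ i, Obs i)
  init : stdSimplex ℝ State
  T : ℕ

attribute [instance] DecPOMDP.fintypeState DecPOMDP.fintypeAct DecPOMDP.fintypeObs

/-- Transport of a distribution along a bijection: `(relabelDist e p) y = p (e⁻¹ y)`. -/
def relabelDist {X Y : Type} [Fintype X] [Fintype Y] (e : X ≃ Y) (p : stdSimplex ℝ X) :
    stdSimplex ℝ Y :=
  ⟨fun y => p (e.symm y), fun y => p.2.1 (e.symm y), by
    rw [← p.2.2]; exact Equiv.sum_comp e.symm (fun x => p x)⟩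

/-- The distribution concentrated on `x`. -/
def pointDist {X : Type} [Fintype X] [DecidableEq X] (x : X) : stdSimplex ℝ X :=
  ⟨Pi.single x 1, single_mem_stdSimplex ℝ x⟩

namespace DecPOMDP

/-! ### Histories, policies, expected return -/

/-- Local action-observation histories of agent `i`: a length `t ≤ T` together with the pairs
`(A_{i,k}, O_{i,k+1})` for `k < t`. -/
abbrev AOHist (D : DecPOMDP) (i : Fin D.N) : Type :=
  Σ t : Fin (D.T + 1), (Fin (t : ℕ) → D.Act i × D.Obs i)

/-- Local stochastic policies of agent `i`; they carry the product (that is, Borel) σ-algebra. -/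
abbrev LocalPolicy (D : DecPOMDP) (i : Fin D.N) : Type :=
  D.AOHist i → stdSimplex ℝ (D.Act i)

/-- Joint policies. -/
abbrev Policy (D : DecPOMDP) : Type := ∀ i, D.LocalPolicy i

/-- Entire histories: states at times `0, …, T`, joint actions at times `0, …, T`, and joint
observations at times `1, …, T` (the entry `k : Fin T` is the observation at time `k + 1`).
Rewards are functions of these. -/
abbrev History (D : DecPOMDP) : Type :=
  (Fin (D.T + 1) → D.State) × (Fin (D.T + 1) → ∀ i, D.Act i) × (Fin D.T → ∀ i, D.Obs i)

def History.state {D : DecPOMDP} (h : D.History) (t : Fin (D.T + 1)) : D.State := h.1 t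

def History.act {D : DecPOMDP} (h : D.History) (t : Fin (D.T + 1)) : ∀ i, D.Act i := h.2.1 t

/-- `h.obs k` is the joint observation at time `k + 1`. -/
def History.obs {D : DecPOMDP} (h : D.History) (k : Fin D.T) : ∀ i, D.Obs i := h.2.2 k

/-- The action-observation history of agent `i` at time `t`. -/
def History.aoHist {D : DecPOMDP} (h : D.History) (i : Fin D.N) (t : Fin (D.T + 1)) :
    D.AOHist i :=
  ⟨t, fun k => (h.act ⟨k, by omega⟩ i, h.obs ⟨k, by omega⟩ i)⟩

/-- The probability of the entire history `h` when the agents follow the joint policy `π`. -/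
def histProb (D : DecPOMDP) (π : D.Policy) (h : D.History) : ℝ :=
  D.init (h.state 0)
    * (∏ t : Fin D.T, D.trans (h.state t.castSucc) (h.act t.castSucc) (h.state t.succ)
        * D.obsKer (h.state t.succ) (h.act t.castSucc) (h.obs t))
    * ∏ t : Fin (D.T + 1), ∏ i, π i (h.aoHist i t) (h.act t i)

/-- The self-play objective: the expected total reward of the joint policy `π`. -/
def J (D : DecPOMDP) (π : D.Policy) : ℝ :=
  ∑ h : D.History, D.histProb π h * ∑ t, D.reward (h.state t) (h.act t)

/-! ### Isomorphisms and pushforward -/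

/-- Isomorphisms of Dec-POMDPs. The joint action `Equiv.piCongr fN fA a` is the one in which
agent `fN i` plays `fA i (a i)`; likewise for joint observations. -/
structure Iso (D E : DecPOMDP) where
  fN : Fin D.N ≃ Fin E.N
  fS : D.State ≃ E.State
  fA : ∀ i, D.Act i ≃ E.Act (fN i)
  fO : ∀ i, D.Obs i ≃ E.Obs (fN i)
  horizon : D.T = E.T
  trans_eq : ∀ s a s', D.trans s a s' = E.trans (fS s) (Equiv.piCongr fN fA a) (fS s')
  obs_eq : ∀ s a o,
    D.obsKer s a o = E.obsKer (fS s) (Equiv.piCongr fN fA a) (Equiv.piCongr fN fO o)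
  reward_eq : ∀ s a, D.reward s a = E.reward (fS s) (Equiv.piCongr fN fA a)
  init_eq : ∀ s, D.init s = E.init (fS s)

/-- Automorphisms. -/
abbrev Aut (D : DecPOMDP) : Type := Iso D D

instance (D E : DecPOMDP) : Finite (Iso D E) := by
  let F : Iso D E → Σ fN : Fin D.N ≃ Fin E.N, (D.State ≃ E.State) ×
      (∀ i, D.Act i ≃ E.Act (fN i)) × (∀ i, D.Obs i ≃ E.Obs (fN i)) :=
    fun f => ⟨f.fN, f.fS, f.fA, f.fO⟩
  refine Finite.of_injective F ?_
  rintro ⟨a, b, c, d, _, _, _, _, _⟩ ⟨a', b', c', d', _, _, _, _, _⟩ h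
  simp only [F, Sigma.mk.injEq] at h
  obtain ⟨rfl, h⟩ := h
  simp only [heq_eq_eq, Prod.mk.injEq] at h
  obtain ⟨rfl, rfl, rfl⟩ := h
  rfl

instance (D E : DecPOMDP) : Fintype (Iso D E) := Fintype.ofFinite _

/-- Element-wise application of `f⁻¹` to an action-observation history of agent `f i`. -/
def Iso.invHist {D E : DecPOMDP} (f : Iso D E) (i : Fin D.N) (τ : E.AOHist (f.fN i)) :
    D.AOHist i :=
  ⟨Fin.cast (by rw [f.horizon]) τ.1,
    fun k => ((f.fA i).symm (τ.2 k).1, (f.fO i).symm (τ.2 k).2)⟩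

/-- The pushforward policy `f^*π`: for `j = f i`,
`(f^*π)_j (a ∣ τ) = π_i (f⁻¹ a ∣ f⁻¹ τ)`. -/
def Iso.push {D E : DecPOMDP} (f : Iso D E) (π : D.Policy) : E.Policy :=
  Equiv.piCongrLeft E.LocalPolicy f.fN
    (fun i τ => relabelDist (f.fA i) (π i (f.invHist i τ)))

/-! ### Other-play -/

/-- For a profile `g` of automorphisms, the joint policy in which agent `i` uses its local policy
in the pushforward of `π` by `g i`. -/
def pushProfile (D : DecPOMDP) (g : Fin D.N → D.Aut) (π : D.Policy) : D.Policy :=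
  fun i => (g i).push π i

/-- The other-play objective (`𝔼` is the average over the uniform distribution). -/
def JOP (D : DecPOMDP) (π : D.Policy) : ℝ :=
  𝔼 g : Fin D.N → D.Aut, D.J (D.pushProfile g π)

/-- OP-optimal policies: the maximizers of the other-play objective. -/
def IsOPOptimal (D : DecPOMDP) (π : D.Policy) : Prop :=
  ∀ π' : D.Policy, D.JOP π' ≤ D.JOP π

/-- Probability of a set of histories under `π`. -/
def prob (D : DecPOMDP) (π : D.Policy) (Q : Set D.History) : ℝ :=
  ∑ h : D.History, Q.indicator (D.histProb π) h

/-- Probability of a set of histories when a joint policy is first sampled from `μ`. -/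
def mixProb (D : DecPOMDP) (μ : Measure D.Policy) (Q : Set D.History) : ℝ :=
  ∫ π, D.prob π Q ∂μ

/-- The event that agent `i` has action-observation history `τ` (at the time given by the
length of `τ`). -/
def reach (D : DecPOMDP) (i : Fin D.N) (τ : D.AOHist i) : Set D.History :=
  {h | h.aoHist i τ.1 = τ}

/-- The event that agent `i` plays `a` at the time given by the length of `τ`. -/
def plays (D : DecPOMDP) (i : Fin D.N) (τ : D.AOHist i) (a : D.Act i) : Set D.History :=
  {h | h.act τ.1 i = a}

/-- A choice of independent distributions over the local policies of all agents, the one of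
agent `i` being `μ`, under which agent `i` has history `τ` with positive probability. -/
def Witness (D : DecPOMDP) (i : Fin D.N) (μ : Measure (D.LocalPolicy i)) (τ : D.AOHist i)
    (ν : ∀ j, ProbabilityMeasure (D.LocalPolicy j)) : Prop :=
  (ν i : Measure (D.LocalPolicy i)) = μ ∧
    0 < D.mixProb (Measure.pi fun j => (ν j : Measure (D.LocalPolicy j))) (D.reach i τ)

open Classical in
/-- The action probabilities of the local policy of agent `i` corresponding to a distribution `μ`
over its local policies: the conditional probability of playing `a` given the history `τ`,
for any choice of independent distributions over the other agents' policies that makes `τ`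
possible, and uniform if there is none. -/
def mixturePolicy (D : DecPOMDP) (i : Fin D.N) (μ : Measure (D.LocalPolicy i))
    (τ : D.AOHist i) (a : D.Act i) : ℝ :=
  if hν : ∃ ν, D.Witness i μ τ ν then
    D.mixProb (Measure.pi fun j => (hν.choose j : Measure (D.LocalPolicy j)))
        (D.plays i τ a ∩ D.reach i τ)
      / D.mixProb (Measure.pi fun j => (hν.choose j : Measure (D.LocalPolicy j))) (D.reach i τ)
  else 1 / Fintype.card (D.Act i)

/-- The other-play distribution of `π`: the uniform mixture of the point masses at the
policies `pushProfile g π`. -/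
def opDist (D : DecPOMDP) (π : D.Policy) : Measure D.Policy :=
  ((Fintype.card D.Aut : ENNReal) ^ D.N)⁻¹ •
    ∑ g : Fin D.N → D.Aut, Measure.dirac (D.pushProfile g π)

/-- The symmetrizer `Ψ`, given by its action probabilities: the policy corresponding to the
marginals of the other-play distribution. -/
def symmetrizer (D : DecPOMDP) (π : D.Policy) (i : Fin D.N) (τ : D.AOHist i) (a : D.Act i) : ℝ :=
  D.mixturePolicy i ((D.opDist π).map fun π' => π' i) τ a

/-- The equivalence class `[π]` of the policies with the same image under the symmetrizer. -/
def opClass (D : DecPOMDP) (π : D.Policy) : Set D.Policy :=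
  {π' | D.symmetrizer π' = D.symmetrizer π}

/-- Pushforward of an equivalence class: `f^*[π] = [f^*π]`. -/
def Iso.pushClass {D E : DecPOMDP} (f : Iso D E) (π : D.Policy) : Set E.Policy :=
  E.opClass (f.push π)

/-! ### Relabeled problems -/

/-- Labelings: bijections from agents, states, actions and observations to the canonical sets of
the same size. -/
structure Labeling (D : DecPOMDP) where
  fN : Fin D.N ≃ Fin D.N
  fS : D.State ≃ Fin (Fintype.card D.State)
  fA : ∀ i, D.Act i ≃ Fin (Fintype.card (D.Act i))
  fO : ∀ i, D.Obs i ≃ Fin (Fintype.card (D.Obs i))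

instance (D : DecPOMDP) : Finite (Labeling D) := by
  let F : Labeling D → (Fin D.N ≃ Fin D.N) × (D.State ≃ Fin (Fintype.card D.State)) ×
      (∀ i, D.Act i ≃ Fin (Fintype.card (D.Act i))) ×
      (∀ i, D.Obs i ≃ Fin (Fintype.card (D.Obs i))) :=
    fun f => ⟨f.fN, f.fS, f.fA, f.fO⟩
  refine Finite.of_injective F ?_
  rintro ⟨a, b, c, d⟩ ⟨a', b', c', d'⟩ h
  simp only [F, Prod.mk.injEq] at h
  obtain ⟨rfl, rfl, rfl, rfl⟩ := h
  rfl

/-- The action of a labeling on joint actions: in the image of `a`, agent `fN i` plays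
`fA i (a i)`. -/
def Labeling.jointAct {D : DecPOMDP} (f : Labeling D) :
    (∀ i, D.Act i) ≃ ∀ j, Fin (Fintype.card (D.Act (f.fN.symm j))) :=
  Equiv.piCongr f.fN fun i => (f.fA i).trans (finCongr (by rw [Equiv.symm_apply_apply]))

/-- The action of a labeling on joint observations. -/
def Labeling.jointObs {D : DecPOMDP} (f : Labeling D) :
    (∀ i, D.Obs i) ≃ ∀ j, Fin (Fintype.card (D.Obs (f.fN.symm j))) :=
  Equiv.piCongr f.fN fun i => (f.fO i).trans (finCongr (by rw [Equiv.symm_apply_apply]))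

/-- The relabeled problem `f^*D`. -/
@[reducible] def relabel (D : DecPOMDP) (f : Labeling D) : DecPOMDP where
  N := D.N
  State := Fin (Fintype.card D.State)
  Act := fun j => Fin (Fintype.card (D.Act (f.fN.symm j)))
  Obs := fun j => Fin (Fintype.card (D.Obs (f.fN.symm j)))
  trans := fun s a => relabelDist f.fS (D.trans (f.fS.symm s) (f.jointAct.symm a))
  reward := fun s a => D.reward (f.fS.symm s) (f.jointAct.symm a)
  obsKer := fun s a => relabelDist f.jointObs (D.obsKer (f.fS.symm s) (f.jointAct.symm a))
  init := relabelDist f.fS D.init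
  T := D.T

/-- The set of all relabeled problems of `D`. -/
def relabelings (D : DecPOMDP) : Set DecPOMDP := Set.range D.relabel

instance (D : DecPOMDP) : Fintype D.relabelings :=
  @Fintype.ofFinite _ (Set.finite_range D.relabel)

/-! ### Learning algorithms and label-free coordination -/

/-- Learning algorithms for a set of Dec-POMDPs. -/
abbrev LearningAlg (C : Set DecPOMDP) : Type 1 :=
  ∀ E : C, ProbabilityMeasure (Policy (E : DecPOMDP))

/-- Other-play learning algorithms: on every problem of `C`, the expected other-play value of
the learned policy is the maximum of the other-play objective. -/
def IsOPAlg {C : Set DecPOMDP} (σ : LearningAlg C) : Prop :=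
  ∀ E : C, IsGreatest (Set.range (JOP (E : DecPOMDP)))
    (∫ π, JOP (E : DecPOMDP) π ∂(σ E : Measure (Policy (E : DecPOMDP))))

/-- Common payoff of the principals in the label-free coordination game for `D`. -/
def lfcPayoff (D : DecPOMDP) (σ : Fin D.N → LearningAlg D.relabelings) : ℝ :=
  𝔼 E : Fin D.N → D.relabelings, 𝔼 f : ∀ j, Iso (E j : DecPOMDP) D,
    ∫ π : Fin D.N → D.Policy, D.J (fun l => π l l)
      ∂(Measure.pi fun k =>
        (σ k (E k) : Measure (Policy (E k : DecPOMDP))).map (f k).push)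

/-- Value of a learning algorithm in the label-free coordination problem for `D`. -/
def lfcValue (D : DecPOMDP) (σ : LearningAlg D.relabelings) : ℝ :=
  D.lfcPayoff fun _ => σ

/-- Optimality in the label-free coordination problem for `D`. -/
def IsLFCOptimal (D : DecPOMDP) (σ : LearningAlg D.relabelings) : Prop :=
  ∀ σ' : LearningAlg D.relabelings, D.lfcValue σ' ≤ D.lfcValue σ

/-- `σ` learns both `[ρ]` and `[ρ']`, where `f E` is a chosen isomorphism from `D` to the relabeled
problem `E`: on each `E`, `σ E` is a mixture, with weights `α E` and `1 - α E`, of a distribution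
concentrated on `(f E)^*[ρ]` and one concentrated on `(f E)^*[ρ']`, and the weight of the first is
positive on some relabeled problem, that of the second on some, possibly different, one. -/
def LearnsBoth (D : DecPOMDP) (ρ ρ' : D.Policy) (f : ∀ E : D.relabelings, Iso D (E : DecPOMDP))
    (σ : LearningAlg D.relabelings) : Prop :=
  ∃ (α : D.relabelings → ℝ) (μ μ' : LearningAlg D.relabelings),
    (∀ E : D.relabelings, α E ∈ Set.Icc (0 : ℝ) 1) ∧
    (∀ E : D.relabelings, (σ E : Measure (Policy (E : DecPOMDP))) =
      ENNReal.ofReal (α E) • (μ E : Measure (Policy (E : DecPOMDP)))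
        + ENNReal.ofReal (1 - α E) • (μ' E : Measure (Policy (E : DecPOMDP)))) ∧
    (∀ E : D.relabelings, (μ E : Measure (Policy (E : DecPOMDP))) ((f E).pushClass ρ) = 1) ∧
    (∀ E : D.relabelings, (μ' E : Measure (Policy (E : DecPOMDP))) ((f E).pushClass ρ') = 1) ∧
    (∃ E : D.relabelings, 0 < α E) ∧ (∃ E : D.relabelings, α E < 1)

end DecPOMDP

/-! ### The two-stage lever game -/

/-- Two agents, one state, two levers, two rounds; the reward is `1` if both agents pull the same
lever and `-1` otherwise, and in the second round each agent observes the other agent's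
previous action. -/
@[reducible] def leverGame : DecPOMDP where
  N := 2
  State := Fin 1
  Act := fun _ => Fin 2
  Obs := fun _ => Fin 2
  trans := fun _ _ => pointDist 0
  reward := fun _ a => if a 0 = a 1 then 1 else -1
  obsKer := fun _ a => pointDist fun i => a i.rev
  init := pointDist 0
  T := 1

/-- The uniform distribution on the two levers. -/
def uniformLever : stdSimplex ℝ (Fin 2) := ⟨fun _ => 1 / 2, fun _ => by norm_num, by norm_num⟩

/-- Both agents randomize uniformly in the first round, and in the second round if their first
actions differed; if these agreed, each plays `r a`, where `a` is the own first action. -/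
def leverPolicy (r : Fin 2 → Fin 2) : leverGame.Policy := fun _ τ =>
  if h : 0 < (τ.1 : ℕ) then
    if (τ.2 ⟨0, h⟩).1 = (τ.2 ⟨0, h⟩).2 then pointDist (r (τ.2 ⟨0, h⟩).1) else uniformLever
  else uniformLever

/-- The policy `π^R`: repeat the first action after successful coordination. -/
def policyR : leverGame.Policy := leverPolicy id

/-- The policy `π^S`: switch to the other action after successful coordination. -/
def policyS : leverGame.Policy := leverPolicy Fin.rev

end

/-!
Measure the actions of an agent of the lever game by signs `±1`, so that the reward is a product
of signs. The expected return is then a sum of products with one factor per agent, each factor a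
mean sign of that agent. When agents draw their policies independently, be it from the symmetries
of other-play or from a learning algorithm run by different principals, the factors can be averaged
one by one, and by the symmetry between levers the first round contributes nothing. Hence both the
other-play value and the label-free coordination value equal `(x ^ 2 - y ^ 2) / 2`, where
`x, y ∈ [-1, 1]` are the averaged tendencies to repeat one's action after equal and after different
first actions. The maximum `1 / 2` of other-play is attained only at `y = 0` and `x = ±1`, the
values of `policyR` and `policyS`, and `(x, y)` determines the class of a policy. Since the value in
label-free coordination is quadratic in averages over the learned policies, learning both classes
pulls `x` strictly between `-1` and `1`.
-/

/-! ### Families of bijections, averages and integrals -/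

theorem piCongr_trans {ι κ l : Type*} {A : ι → Type*} {B : κ → Type*} {C : l → Type*}
    (e : ι ≃ κ) (e' : κ ≃ l) (F : ∀ i, A i ≃ B (e i)) (G : ∀ k, B k ≃ C (e' k)) (a : ∀ i, A i) :
    Equiv.piCongr (e.trans e') (fun i => (F i).trans (G (e i)) : ∀ i, A i ≃ C (e.trans e' i)) a
      = Equiv.piCongr e' G (Equiv.piCongr e F a) := by
  funext k
  obtain ⟨i, rfl⟩ := (e.trans e').surjective k
  rw [Equiv.piCongr_apply_apply]
  simp only [Equiv.trans_apply, Equiv.piCongr_apply_apply]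
  rfl

theorem piCongr_refl {ι : Type*} {A : ι → Type*} (a : ∀ i, A i) :
    Equiv.piCongr (Equiv.refl ι) (fun i => Equiv.refl (A i)) a = a := by
  funext i
  exact Equiv.piCongr_apply_apply (Equiv.refl ι) (fun i => Equiv.refl (A i)) a i

/-- The inverse of a family of bijections over a bijection of index types. -/
def familySymm {ι κ : Type*} {A : ι → Type*} {B : κ → Type*}
    (e : ι ≃ κ) (F : ∀ i, A i ≃ B (e i)) (k : κ) : B k ≃ A (e.symm k) :=
  (Equiv.cast (congrArg B (e.apply_symm_apply k).symm)).trans (F (e.symm k)).symm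

theorem piCongr_familySymm {ι κ : Type*} {A : ι → Type*} {B : κ → Type*}
    (e : ι ≃ κ) (F : ∀ i, A i ≃ B (e i)) (b : ∀ k, B k) :
    Equiv.piCongr e.symm (familySymm e F) b = (Equiv.piCongr e F).symm b := by
  have cast_apply_eq : ∀ k k' (_ : k = k') (h' : B k = B k'), cast h' (b k) = b k' := by
    rintro k _ rfl _
    rfl
  funext i
  obtain ⟨k, rfl⟩ := e.symm.surjective i
  rw [Equiv.piCongr_apply_apply, Equiv.piCongr_symm_apply]
  simp only [familySymm, Equiv.trans_apply, Equiv.cast_apply]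
  rw [cast_apply_eq k _ (e.apply_symm_apply k).symm]

theorem expect_pi_prod {ι : Type*} [Fintype ι] [DecidableEq ι] {A : ι → Type*}
    [∀ i, Fintype (A i)] {K : Type*} [Semifield K] [CharZero K] (F : ∀ i, A i → K) :
    𝔼 g : ∀ i, A i, ∏ i, F i (g i) = ∏ i, 𝔼 a, F i a := by
  simp only [Fintype.expect_eq_sum_div_card, Finset.prod_div_distrib, Fintype.prod_sum,
    Fintype.card_pi, Nat.cast_prod]

theorem expect_pi_apply {ι A K : Type*} [Fintype ι] [DecidableEq ι] [Fintype A] [Nonempty A]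
    [Semifield K] [CharZero K] (G : A → K) (i : ι) : 𝔼 g : ι → A, G (g i) = 𝔼 a, G a := by
  have expect_ite (j : ι) : 𝔼 a, (if j = i then G a else 1) = if j = i then 𝔼 a, G a else 1 := by
    split_ifs
    · rfl
    · exact Finset.expect_const Finset.univ_nonempty 1
  simpa only [expect_ite, Finset.prod_ite_eq', Finset.mem_univ, if_true]
    using expect_pi_prod fun j (a : A) => if j = i then G a else 1

theorem continuous_stdSimplex_apply {X : Type*} [Fintype X] (x : X) :
    Continuous fun p : stdSimplex ℝ X => p x :=
  (continuous_apply x).comp continuous_subtype_val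

theorem continuous_relabelDist {X Y : Type} [Fintype X] [Fintype Y] (e : X ≃ Y) :
    Continuous (relabelDist e) :=
  Continuous.subtype_mk (continuous_pi fun y => continuous_stdSimplex_apply (e.symm y)) _

@[simp] theorem relabelDist_apply {X Y : Type} [Fintype X] [Fintype Y] (e : X ≃ Y)
    (p : stdSimplex ℝ X) (y : Y) : relabelDist e p y = p (e.symm y) := rfl

theorem integrable_of_continuous {X : Type*} [TopologicalSpace X] [CompactSpace X]
    [MeasurableSpace X] [OpensMeasurableSpace X] {V : Type*} [NormedAddCommGroup V] {μ : Measure X}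
    [IsFiniteMeasure μ] {f : X → V} (hf : Continuous f) : Integrable f μ :=
  hf.integrable_of_hasCompactSupport (HasCompactSupport.of_compactSpace f)

theorem integral_pi_mul {ι : Type*} [Fintype ι] {X : ι → Type*} [∀ i, MeasurableSpace (X i)]
    {μ : ∀ i, Measure (X i)} [∀ i, IsProbabilityMeasure (μ i)] {𝕜 : Type*} [RCLike 𝕜] {i j : ι}
    (hij : i ≠ j) {f : X i → 𝕜} {g : X j → 𝕜} (hf : AEStronglyMeasurable f (μ i))
    (hg : AEStronglyMeasurable g (μ j)) :
    ∫ x, f (x i) * g (x j) ∂Measure.pi μ = (∫ y, f y ∂μ i) * ∫ z, g z ∂μ j := by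
  have indep : ProbabilityTheory.IndepFun (fun x : ∀ i, X i => x i) (fun x => x j)
      (Measure.pi μ) :=
    (ProbabilityTheory.iIndepFun_pi fun _ => aemeasurable_id).indepFun hij
  rw [← integral_comp_eval hf, ← integral_comp_eval hg]
  refine indep.integral_fun_comp_mul_comp (measurable_pi_apply i).aemeasurable
    (measurable_pi_apply j).aemeasurable ?_ ?_
  · rwa [(measurePreserving_eval μ i).map_eq]
  · rwa [(measurePreserving_eval μ j).map_eq]

theorem finTwo_ne_rev (i : Fin 2) : i ≠ i.rev := by
  revert i
  decide

theorem perm_finTwo_rev (e : Equiv.Perm (Fin 2)) (i : Fin 2) : e i.rev = (e i).rev := by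
  revert e i
  decide

theorem apply_perm_finTwo_eq_iff {X : Type*} (e : Equiv.Perm (Fin 2)) (u : Fin 2 → X) :
    u (e 0) = u (e 1) ↔ u 0 = u 1 := by
  have perm_eq : ∀ e : Equiv.Perm (Fin 2), e = 1 ∨ e = Fin.revPerm := by decide
  rcases perm_eq e with rfl | rfl
  · rfl
  · exact eq_comm

theorem prod_finTwo_eq_mul_rev {M : Type*} [CommMonoid M] (f : Fin 2 → M) (i : Fin 2) :
    ∏ j, f j = f i * f i.rev := by
  rw [Fin.prod_univ_two]
  fin_cases i
  · rfl
  · exact mul_comm _ _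

theorem sum_finTwo_fun {X M : Type*} [Fintype X] [AddCommMonoid M] (F : X → X → M) (i : Fin 2) :
    ∑ u : Fin 2 → X, F (u i) (u i.rev) = ∑ x, ∑ y, F x y := by
  have sum_zero (F : X → X → M) : ∑ u : Fin 2 → X, F (u 0) (u 1) = ∑ x, ∑ y, F x y := by
    rw [← Fintype.sum_prod_type' (f := F)]
    exact Fintype.sum_equiv (finTwoArrowEquiv X) _ _ fun u => rfl
  fin_cases i
  · exact sum_zero F
  · exact (sum_zero fun x y => F y x).trans Finset.sum_comm

namespace DecPOMDP

variable {D E F : DecPOMDP}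

/-! ### Composition and inversion of isomorphisms -/

namespace Iso

/-- The identity isomorphism. -/
def refl (D : DecPOMDP) : Iso D D where
  fN := Equiv.refl _
  fS := Equiv.refl _
  fA _ := Equiv.refl _
  fO _ := Equiv.refl _
  horizon := rfl
  trans_eq s a s' := by rw [piCongr_refl]; rfl
  obs_eq s a o := by rw [piCongr_refl, piCongr_refl]; rfl
  reward_eq s a := by rw [piCongr_refl]; rfl
  init_eq _ := rfl

/-- Composition of isomorphisms. -/
def trans (f : Iso D E) (h : Iso E F) : Iso D F where
  fN := f.fN.trans h.fN
  fS := f.fS.trans h.fS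
  fA i := (f.fA i).trans (h.fA (f.fN i))
  fO i := (f.fO i).trans (h.fO (f.fN i))
  horizon := f.horizon.trans h.horizon
  trans_eq s a s' := by rw [f.trans_eq, h.trans_eq, piCongr_trans]; rfl
  obs_eq s a o := by rw [f.obs_eq, h.obs_eq, piCongr_trans, piCongr_trans]; rfl
  reward_eq s a := by rw [f.reward_eq, h.reward_eq, piCongr_trans]; rfl
  init_eq s := by rw [f.init_eq, h.init_eq]; rfl

/-- The inverse of an isomorphism. -/
def symm (f : Iso D E) : Iso E D where
  fN := f.fN.symm
  fS := f.fS.symm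
  fA := familySymm f.fN f.fA
  fO := familySymm f.fN f.fO
  horizon := f.horizon.symm
  trans_eq s a s' := by simp only [f.trans_eq, piCongr_familySymm, Equiv.apply_symm_apply]
  obs_eq s a o := by simp only [f.obs_eq, piCongr_familySymm, Equiv.apply_symm_apply]
  reward_eq s a := by simp only [f.reward_eq, piCongr_familySymm, Equiv.apply_symm_apply]
  init_eq s := by rw [f.init_eq, Equiv.apply_symm_apply]

instance : Nonempty D.Aut := ⟨refl D⟩

/-- The bijection of an isomorphism between the actions of all agents, tagged with the agent.
Unlike `fA`, its type does not depend on the isomorphism. -/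
def actMap (f : Iso D E) : (Σ i, D.Act i) → Σ j, E.Act j := Sigma.map f.fN fun i => f.fA i

/-- The bijection of an isomorphism between the observations of all agents, tagged with the
agent. -/
def obsMap (f : Iso D E) : (Σ i, D.Obs i) → Σ j, E.Obs j := Sigma.map f.fN fun i => f.fO i

theorem ext_of_maps {f g : Iso D E} (hN : ⇑f.fN = g.fN) (hS : ⇑f.fS = g.fS)
    (hA : f.actMap = g.actMap) (hO : f.obsMap = g.obsMap) : f = g := by
  obtain ⟨fN, fS, fA, fO, _, _, _, _, _⟩ := f
  obtain ⟨gN, gS, gA, gO, _, _, _, _, _⟩ := g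
  obtain rfl : fN = gN := DFunLike.coe_injective hN
  obtain rfl : fS = gS := DFunLike.coe_injective hS
  obtain rfl : fA = gA := funext fun i => Equiv.ext fun a => sigma_mk_injective (congrFun hA ⟨i, a⟩)
  obtain rfl : fO = gO := funext fun i => Equiv.ext fun o => sigma_mk_injective (congrFun hO ⟨i, o⟩)
  rfl

theorem trans_left_injective (f : Iso D E) :
    Function.Injective (f.trans : Iso E F → Iso D F) := fun _ _ e =>
  ext_of_maps
    (f.fN.surjective.injective_comp_right (congrArg (fun k : Iso D F => ⇑k.fN) e))
    (f.fS.surjective.injective_comp_right (congrArg (fun k : Iso D F => ⇑k.fS) e))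
    ((f.fN.surjective.sigma_map fun i => (f.fA i).surjective).injective_comp_right
      (congrArg actMap e))
    ((f.fN.surjective.sigma_map fun i => (f.fO i).surjective).injective_comp_right
      (congrArg obsMap e))

theorem trans_right_injective (f : Iso E F) :
    Function.Injective fun h : Iso D E => h.trans f := fun _ _ e =>
  ext_of_maps
    (f.fN.injective.comp_left (congrArg (fun k : Iso D F => ⇑k.fN) e))
    (f.fS.injective.comp_left (congrArg (fun k : Iso D F => ⇑k.fS) e))
    ((f.fN.injective.sigma_map fun i => (f.fA i).injective).comp_left (congrArg actMap e))
    ((f.fN.injective.sigma_map fun i => (f.fO i).injective).comp_left (congrArg obsMap e))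

theorem trans_left_bijective (f : Iso D E) :
    Function.Bijective (f.trans : Iso E F → Iso D F) :=
  (Fintype.bijective_iff_injective_and_card _).2 ⟨f.trans_left_injective,
    le_antisymm (Fintype.card_le_of_injective _ f.trans_left_injective)
      (Fintype.card_le_of_injective _ f.symm.trans_left_injective)⟩

theorem trans_right_bijective (f : Iso E F) :
    Function.Bijective fun h : Iso D E => h.trans f :=
  (Fintype.bijective_iff_injective_and_card _).2 ⟨f.trans_right_injective,
    le_antisymm (Fintype.card_le_of_injective _ f.trans_right_injective)
      (Fintype.card_le_of_injective _ f.symm.trans_right_injective)⟩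

/-- Conjugation of automorphisms by an isomorphism. -/
noncomputable def conj (f : Iso D E) : D.Aut ≃ E.Aut :=
  (Equiv.ofBijective _ f.trans_right_bijective).trans
    (Equiv.ofBijective _ f.trans_left_bijective).symm

theorem trans_conj (f : Iso D E) (g : D.Aut) : f.trans (f.conj g) = g.trans f :=
  (Equiv.ofBijective _ f.trans_left_bijective).apply_symm_apply (g.trans f)

/-! ### Pushforward of policies -/

/-- Element-wise application of an isomorphism to an action-observation history. -/
def mapHist (f : Iso D E) (i : Fin D.N) (τ : D.AOHist i) : E.AOHist (f.fN i) :=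
  ⟨Fin.cast (by rw [f.horizon]) τ.1, fun k => (f.fA i (τ.2 k).1, f.fO i (τ.2 k).2)⟩

@[simp] theorem invHist_mapHist (f : Iso D E) (i : Fin D.N) (τ : D.AOHist i) :
    f.invHist i (f.mapHist i τ) = τ :=
  Sigma.ext rfl (heq_of_eq (by funext k; simp [invHist, mapHist]))

@[simp] theorem mapHist_invHist (f : Iso D E) (i : Fin D.N) (τ : E.AOHist (f.fN i)) :
    f.mapHist i (f.invHist i τ) = τ :=
  Sigma.ext rfl (heq_of_eq (by funext k; simp [invHist, mapHist]))

/-- The pushforward of local policies of agent `i`. -/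
def pushLocal (f : Iso D E) (i : Fin D.N) : D.LocalPolicy i ≃ₜ E.LocalPolicy (f.fN i) where
  toFun p τ := relabelDist (f.fA i) (p (f.invHist i τ))
  invFun q τ := relabelDist (f.fA i).symm (q (f.mapHist i τ))
  left_inv p := by funext τ; ext a; simp
  right_inv q := by funext τ; ext a; simp
  continuous_toFun := continuous_pi fun _ =>
    (continuous_relabelDist _).comp (continuous_apply _)
  continuous_invFun := continuous_pi fun _ =>
    (continuous_relabelDist _).comp (continuous_apply _)

theorem pushLocal_apply (f : Iso D E) (i : Fin D.N) (p : D.LocalPolicy i)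
    (τ : E.AOHist (f.fN i)) (a : E.Act (f.fN i)) :
    f.pushLocal i p τ a = p (f.invHist i τ) ((f.fA i).symm a) := rfl

theorem push_fN (f : Iso D E) (π : D.Policy) (i : Fin D.N) :
    f.push π (f.fN i) = f.pushLocal i (π i) :=
  Equiv.piCongrLeft_apply_apply E.LocalPolicy f.fN _ i

theorem push_surjective (f : Iso D E) : Function.Surjective f.push := by
  intro ρ
  refine ⟨fun i => (f.pushLocal i).symm (ρ (f.fN i)), ?_⟩
  funext j
  obtain ⟨i, rfl⟩ := f.fN.surjective j
  rw [f.push_fN]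
  exact (f.pushLocal i).apply_symm_apply _

theorem continuous_push (f : Iso D E) : Continuous f.push := by
  refine continuous_pi fun j => ?_
  obtain ⟨i, rfl⟩ := f.fN.surjective j
  simp only [f.push_fN]
  exact (f.pushLocal i).continuous.comp (continuous_apply i)

theorem push_trans (f : Iso D E) (h : Iso E F) (π : D.Policy) :
    (f.trans h).push π = h.push (f.push π) := by
  funext k
  obtain ⟨i, rfl⟩ := (f.trans h).fN.surjective k
  rw [push_fN]
  change _ = h.push (f.push π) (h.fN (f.fN i))
  rw [push_fN, push_fN]
  rfl

/-! ### Invariance of the return and of other-play -/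

/-- Element-wise application of an isomorphism to entire histories. -/
def history (f : Iso D E) : D.History ≃ E.History :=
  (Equiv.arrowCongr (finCongr (by rw [f.horizon])) f.fS).prodCongr
    ((Equiv.arrowCongr (finCongr (by rw [f.horizon])) (Equiv.piCongr f.fN f.fA)).prodCongr
      (Equiv.arrowCongr (finCongr f.horizon) (Equiv.piCongr f.fN f.fO)))

theorem history_state (f : Iso D E) (h : D.History) (t : Fin (E.T + 1)) :
    (f.history h).state t = f.fS (h.state (Fin.cast (by rw [f.horizon]) t)) := rfl

theorem history_act (f : Iso D E) (h : D.History) (t : Fin (E.T + 1)) :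
    (f.history h).act t = Equiv.piCongr f.fN f.fA (h.act (Fin.cast (by rw [f.horizon]) t)) := rfl

theorem history_obs (f : Iso D E) (h : D.History) (t : Fin E.T) :
    (f.history h).obs t = Equiv.piCongr f.fN f.fO (h.obs (Fin.cast (by rw [f.horizon]) t)) := rfl

theorem history_aoHist (f : Iso D E) (h : D.History) (i : Fin D.N) (t : Fin (E.T + 1)) :
    (f.history h).aoHist (f.fN i) t
      = f.mapHist i (h.aoHist i (Fin.cast (by rw [f.horizon]) t)) := by
  refine Sigma.ext rfl (heq_of_eq ?_)
  funext k
  simp only [History.aoHist, f.history_act, f.history_obs, Equiv.piCongr_apply_apply, mapHist]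
  rfl

theorem histProb_push (f : Iso D E) (π : D.Policy) (h : D.History) :
    E.histProb (f.push π) (f.history h) = D.histProb π h := by
  unfold histProb
  congr 1
  · congr 1
    · rw [f.init_eq, f.history_state]; rfl
    · refine (Fintype.prod_equiv (finCongr f.horizon) _ _ fun t => ?_).symm
      rw [f.trans_eq, f.obs_eq, f.history_state, f.history_state, f.history_act, f.history_obs]
      rfl
  · refine (Fintype.prod_equiv (finCongr (by rw [f.horizon])) _ _ fun t => ?_).symm
    refine Fintype.prod_equiv f.fN _ _ fun i => ?_
    rw [f.push_fN, f.history_aoHist, f.history_act, Equiv.piCongr_apply_apply, f.pushLocal_apply,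
      f.invHist_mapHist, Equiv.symm_apply_apply]
    rfl

theorem J_push (f : Iso D E) (π : D.Policy) : E.J (f.push π) = D.J π := by
  refine (Fintype.sum_equiv f.history _ _ fun h => ?_).symm
  rw [f.histProb_push]
  congr 1
  refine Fintype.sum_equiv (finCongr (by rw [f.horizon])) _ _ fun t => ?_
  rw [f.reward_eq, f.history_state, f.history_act]
  rfl

theorem prob_push (f : Iso D E) (π : D.Policy) (Q : Set E.History) :
    E.prob (f.push π) Q = D.prob π (f.history ⁻¹' Q) := by
  classical
  refine (Fintype.sum_equiv f.history _ _ fun h => ?_).symm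
  simp only [Set.indicator_apply, Set.mem_preimage, f.histProb_push]

/-- Conjugation of profiles of automorphisms by an isomorphism. -/
noncomputable def conjProfile (f : Iso D E) : (Fin D.N → D.Aut) ≃ (Fin E.N → E.Aut) :=
  Equiv.arrowCongr f.fN f.conj

theorem pushProfile_conjProfile (f : Iso D E) (g : Fin D.N → D.Aut) (π : D.Policy) :
    E.pushProfile (f.conjProfile g) (f.push π) = f.push (D.pushProfile g π) := by
  funext j
  obtain ⟨i, rfl⟩ := f.fN.surjective j
  rw [f.push_fN]
  simp only [pushProfile, conjProfile, Equiv.arrowCongr_apply, Function.comp_apply,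
    Equiv.symm_apply_apply]
  rw [← push_trans, f.trans_conj, push_trans, f.push_fN]

theorem JOP_push (f : Iso D E) (π : D.Policy) : E.JOP (f.push π) = D.JOP π := by
  refine (Fintype.expect_equiv f.conjProfile _ _ fun g => ?_).symm
  rw [f.pushProfile_conjProfile, f.J_push]

theorem isOPOptimal_push_iff (f : Iso D E) {π : D.Policy} :
    E.IsOPOptimal (f.push π) ↔ D.IsOPOptimal π := by
  simp only [IsOPOptimal, f.push_surjective.forall, f.JOP_push]

end Iso

/-! ### Continuity, and learning algorithms supported on optimal policies -/

theorem continuous_histProb (h : D.History) : Continuous fun π : D.Policy => D.histProb π h := by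
  refine continuous_const.mul
    (continuous_finsetProd _ fun t _ => continuous_finsetProd _ fun i _ => ?_)
  exact (continuous_stdSimplex_apply _).comp ((continuous_apply _).comp (continuous_apply i))

theorem continuous_prob (Q : Set D.History) : Continuous fun π : D.Policy => D.prob π Q := by
  classical
  refine continuous_finsetSum _ fun h _ => ?_
  by_cases hQ : h ∈ Q
  · simpa only [Set.indicator_of_mem hQ] using continuous_histProb h
  · simpa only [Set.indicator_of_notMem hQ] using continuous_const

instance : Nonempty D.relabelings :=
  ⟨⟨_, ⟨⟨Equiv.refl _, Fintype.equivFin _, fun _ => Fintype.equivFin _,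
    fun _ => Fintype.equivFin _⟩, rfl⟩⟩⟩

theorem isOPAlg_of_ae_isOPOptimal {C : Set DecPOMDP} {σ : LearningAlg C}
    (h : ∀ E : C, ∀ᵐ ρ ∂(σ E : Measure (Policy (E : DecPOMDP))),
      (E : DecPOMDP).IsOPOptimal ρ) : IsOPAlg σ := by
  intro E
  obtain ⟨ρ₀, hρ₀⟩ := (h E).exists
  have JOP_ae : ∀ᵐ ρ ∂(σ E : Measure (Policy (E : DecPOMDP))),
      (E : DecPOMDP).JOP ρ = (E : DecPOMDP).JOP ρ₀ := by
    filter_upwards [h E] with ρ hρ using le_antisymm (hρ₀ ρ) (hρ ρ₀)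
  rw [integral_congr_ae JOP_ae, integral_const, probReal_univ, one_smul]
  exact ⟨⟨ρ₀, rfl⟩, Set.forall_mem_range.2 hρ₀⟩

/-! ### Averages over isomorphisms -/

/-- The average of `G` over the local policies that agent `i` of `D` obtains when the joint policy
`ρ` of `E` is pushed forward along a uniformly random isomorphism from `E` to `D`. -/
noncomputable def isoMean (i : Fin D.N) (G : D.LocalPolicy i → ℝ) (ρ : E.Policy) : ℝ :=
  𝔼 h : Iso E D, G (h.push ρ i)

theorem isoMean_push (f : Iso E F) (i : Fin D.N) (G : D.LocalPolicy i → ℝ) (ρ : E.Policy) :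
    isoMean i G (f.push ρ) = isoMean i G ρ :=
  Fintype.expect_bijective _ f.trans_left_bijective _ _ fun h => by rw [Iso.push_trans]

theorem isoMean_comp_pushLocal (f : Iso D F) (i : Fin D.N) (G : F.LocalPolicy (f.fN i) → ℝ)
    (ρ : E.Policy) : isoMean i (fun p => G (f.pushLocal i p)) ρ = isoMean (f.fN i) G ρ :=
  Fintype.expect_bijective _ f.trans_right_bijective _ _ fun h => by
    rw [Iso.push_trans, f.push_fN]

theorem continuous_isoMean {i : Fin D.N} {G : D.LocalPolicy i → ℝ} (hG : Continuous G) :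
    Continuous (isoMean i G : E.Policy → ℝ) := by
  unfold isoMean
  simp only [Fintype.expect_eq_sum_div_card]
  exact (continuous_finsetSum _ fun h _ =>
    hG.comp ((continuous_apply i).comp h.continuous_push)).div_const _

section SumOfProducts

variable {κ : Type*} [Fintype κ] {φ : κ → ∀ i, D.LocalPolicy i → ℝ}

theorem JOP_eq_sum_prod_isoMean (hJ : ∀ π, D.J π = ∑ c, ∏ i, φ c i (π i)) (π : D.Policy) :
    D.JOP π = ∑ c, ∏ i, isoMean i (φ c i) π := by
  simp only [JOP, hJ, Finset.expect_sum_comm]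
  exact Finset.sum_congr rfl fun c _ => expect_pi_prod fun i (g : D.Aut) => φ c i (g.push π i)

theorem integral_sum_prod_eq {A : Fin D.N → DecPOMDP} (f : ∀ j, Iso (A j) D)
    (μ : ∀ j, ProbabilityMeasure (A j).Policy) (hφ : ∀ c i, Continuous (φ c i)) :
    ∫ π : Fin D.N → D.Policy, ∑ c, ∏ l, φ c l (π l l)
        ∂(Measure.pi fun j => (μ j : Measure (A j).Policy).map (f j).push)
      = ∑ c, ∏ l, ∫ ρ, φ c l ((f l).push ρ l) ∂(μ l : Measure (A l).Policy) := by
  have hm : ∀ j, Measurable (f j).push := fun j => (f j).continuous_push.measurable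
  have (j : Fin D.N) : IsProbabilityMeasure ((μ j : Measure (A j).Policy).map (f j).push) :=
    Measure.isProbabilityMeasure_map (hm j).aemeasurable
  have hc : ∀ c l, Continuous fun π : D.Policy => φ c l (π l) := fun c l =>
    (hφ c l).comp (continuous_apply l)
  rw [integral_finsetSum _ fun c _ => Integrable.fintype_prod fun l =>
    integrable_of_continuous (hc c l)]
  refine Finset.sum_congr rfl fun c _ => ?_
  rw [integral_fintype_prod_eq_prod fun l (π : D.Policy) => φ c l (π l)]
  exact Finset.prod_congr rfl fun l _ =>
    integral_map (hm l).aemeasurable (hc c l).aestronglyMeasurable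

theorem integral_isoMean {i : Fin D.N} {G : D.LocalPolicy i → ℝ} (hG : Continuous G)
    (μ : Measure E.Policy) [IsFiniteMeasure μ] :
    ∫ ρ, isoMean i G ρ ∂μ = 𝔼 h : Iso E D, ∫ ρ, G (h.push ρ i) ∂μ := by
  simp only [isoMean, Fintype.expect_eq_sum_div_card]
  have hc : ∀ h : Iso E D, Continuous fun ρ => G (h.push ρ i) := fun h =>
    hG.comp ((continuous_apply i).comp h.continuous_push)
  rw [integral_div, integral_finsetSum _ fun h _ => integrable_of_continuous (hc h)]

theorem lfcValue_eq_sum_prod_isoMean (hJ : ∀ π, D.J π = ∑ c, ∏ i, φ c i (π i))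
    (hφ : ∀ c i, Continuous (φ c i)) (σ : LearningAlg D.relabelings) :
    D.lfcValue σ = ∑ c, ∏ i, 𝔼 E : D.relabelings,
      ∫ ρ, isoMean i (φ c i) ρ ∂(σ E : Measure (Policy (E : DecPOMDP))) := by
  have integral_payoff (A : Fin D.N → D.relabelings) (f : ∀ j, Iso (A j : DecPOMDP) D) :=
    integral_sum_prod_eq f (fun j => σ (A j)) hφ
  simp only [lfcValue, lfcPayoff, hJ, integral_payoff, integral_isoMean (hφ _ _),
    Finset.expect_sum_comm, ← expect_pi_prod]

end SumOfProducts

/-! ### The other-play distribution -/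

/-- The law of the local policy of agent `i` under the other-play distribution of `π`. -/
noncomputable def opMarginal (π : D.Policy) (i : Fin D.N) : Measure (D.LocalPolicy i) :=
  (D.opDist π).map fun π' => π' i

instance (π : D.Policy) : IsProbabilityMeasure (D.opDist π) := by
  constructor
  simp only [opDist, Measure.smul_apply, Measure.finsetSum_apply, measure_univ, smul_eq_mul,
    Finset.sum_const, Finset.card_univ, Fintype.card_fun, Fintype.card_fin, nsmul_eq_mul, mul_one,
    Nat.cast_pow]
  exact ENNReal.inv_mul_cancel (pow_ne_zero _ (Nat.cast_ne_zero.2 Fintype.card_ne_zero))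
    (ENNReal.pow_ne_top (ENNReal.natCast_ne_top _))

instance (π : D.Policy) (i : Fin D.N) : IsProbabilityMeasure (opMarginal π i) :=
  Measure.isProbabilityMeasure_map (measurable_pi_apply i).aemeasurable

theorem integral_opDist (π : D.Policy) {G : D.Policy → ℝ} (hG : Continuous G) :
    ∫ π', G π' ∂D.opDist π = 𝔼 g : Fin D.N → D.Aut, G (D.pushProfile g π) := by
  rw [opDist, integral_smul_measure, integral_finsetSum_measure fun g _ =>
    integrable_of_continuous hG]
  simp only [integral_dirac' _ _ hG.stronglyMeasurable, Fintype.expect_eq_sum_div_card,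
    Fintype.card_fun, Fintype.card_fin, ENNReal.toReal_inv, ENNReal.toReal_pow,
    ENNReal.toReal_natCast, smul_eq_mul, Nat.cast_pow]
  exact (div_eq_inv_mul _ _).symm

theorem integral_opMarginal (π : D.Policy) (i : Fin D.N) {G : D.LocalPolicy i → ℝ}
    (hG : Continuous G) : ∫ p, G p ∂opMarginal π i = isoMean i G π := by
  have hc : Continuous fun π' : D.Policy => G (π' i) := hG.comp (continuous_apply i)
  rw [opMarginal, integral_map (measurable_pi_apply i).aemeasurable hG.aestronglyMeasurable,
    integral_opDist π hc]
  exact expect_pi_apply (fun g : D.Aut => G (g.push π i)) i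

namespace Iso

theorem opDist_push (f : Iso D E) (π : D.Policy) :
    E.opDist (f.push π) = (D.opDist π).map f.push := by
  have hm := f.continuous_push.measurable
  have hN : E.N = D.N := Fin.equiv_iff_eq.1 ⟨f.fN.symm⟩
  simp only [opDist, Measure.map_smul, Measure.map_finset_sum hm.aemeasurable,
    Measure.map_dirac' hm, Fintype.card_congr f.conj, hN]
  congr 1
  exact (Fintype.sum_equiv f.conjProfile _ _ fun g => by rw [f.pushProfile_conjProfile]).symm

theorem opMarginal_push (f : Iso D E) (π : D.Policy) (i : Fin D.N) :
    opMarginal (f.push π) (f.fN i) = (opMarginal π i).map (f.pushLocal i) := by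
  rw [opMarginal, opMarginal, f.opDist_push,
    Measure.map_map (measurable_pi_apply _) f.continuous_push.measurable,
    Measure.map_map (f.pushLocal i).continuous.measurable (measurable_pi_apply _)]
  exact congrArg (Measure.map · (D.opDist π)) (funext fun π' => f.push_fN π' i)

end Iso

/-! ### Equivariance of the symmetrizer -/

/-- The conditional probability that agent `i` plays `a` given its history `τ`, when the local
policies are drawn independently from `ν`. -/
noncomputable def condPlay (i : Fin D.N) (ν : ∀ j, ProbabilityMeasure (D.LocalPolicy j))
    (τ : D.AOHist i) (a : D.Act i) : ℝ :=
  D.mixProb (Measure.pi fun j => (ν j : Measure (D.LocalPolicy j))) (D.plays i τ a ∩ D.reach i τ)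
    / D.mixProb (Measure.pi fun j => (ν j : Measure (D.LocalPolicy j))) (D.reach i τ)

/-- The conditional probabilities defining `mixturePolicy` do not depend on the chosen witness. -/
def HasIndependentMixtures (D : DecPOMDP) : Prop :=
  ∀ ⦃i : Fin D.N⦄ ⦃μ : Measure (D.LocalPolicy i)⦄ ⦃τ : D.AOHist i⦄
    ⦃ν ν' : ∀ j, ProbabilityMeasure (D.LocalPolicy j)⦄,
    D.Witness i μ τ ν → D.Witness i μ τ ν' → condPlay i ν τ = condPlay i ν' τ

theorem HasIndependentMixtures.mixturePolicy_eq (hD : D.HasIndependentMixtures) {i : Fin D.N}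
    {μ : Measure (D.LocalPolicy i)} {τ : D.AOHist i}
    {ν : ∀ j, ProbabilityMeasure (D.LocalPolicy j)} (hν : D.Witness i μ τ ν) :
    D.mixturePolicy i μ τ = condPlay i ν τ := by
  have hex : ∃ ν, D.Witness i μ τ ν := ⟨ν, hν⟩
  funext a
  rw [mixturePolicy, dif_pos hex]
  exact congrFun (hD hex.choose_spec hν) a

theorem mixturePolicy_eq_of_forall_condPlay_eq {i : Fin D.N} {μ : Measure (D.LocalPolicy i)}
    {τ : D.AOHist i} {a : D.Act i} {c : ℝ} (hex : ∃ ν, D.Witness i μ τ ν)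
    (hc : ∀ ν, D.Witness i μ τ ν → condPlay i ν τ a = c) : D.mixturePolicy i μ τ a = c := by
  rw [mixturePolicy, dif_pos hex]
  exact hc _ hex.choose_spec

namespace Iso

/-- Pushforward of a family of distributions over local policies. -/
noncomputable def pushMixture (f : Iso D E) (ν : ∀ i, ProbabilityMeasure (D.LocalPolicy i)) :
    ∀ j, ProbabilityMeasure (E.LocalPolicy j) :=
  Equiv.piCongrLeft (fun j => ProbabilityMeasure (E.LocalPolicy j)) f.fN
    fun i => (ν i).map (f.pushLocal i).continuous.aemeasurable

theorem pushMixture_fN (f : Iso D E) (ν : ∀ i, ProbabilityMeasure (D.LocalPolicy i))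
    (i : Fin D.N) :
    (f.pushMixture ν (f.fN i) : Measure (E.LocalPolicy (f.fN i)))
      = (ν i : Measure (D.LocalPolicy i)).map (f.pushLocal i) := by
  rw [pushMixture, Equiv.piCongrLeft_apply_apply]
  rfl

theorem pushMixture_surjective (f : Iso D E) : Function.Surjective f.pushMixture := by
  intro ν
  refine ⟨fun i => (ν (f.fN i)).map (f.pushLocal i).symm.continuous.aemeasurable, ?_⟩
  funext j
  obtain ⟨i, rfl⟩ := f.fN.surjective j
  apply Subtype.ext
  change (f.pushMixture _ (f.fN i) : Measure (E.LocalPolicy (f.fN i))) = _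
  rw [f.pushMixture_fN, ProbabilityMeasure.toMeasure_map,
    Measure.map_map (f.pushLocal i).continuous.measurable
      (f.pushLocal i).symm.continuous.measurable,
    Homeomorph.self_comp_symm, Measure.map_id]
  rfl

theorem pi_pushMixture (f : Iso D E) (ν : ∀ i, ProbabilityMeasure (D.LocalPolicy i)) :
    Measure.pi (fun j => (f.pushMixture ν j : Measure (E.LocalPolicy j)))
      = (Measure.pi fun i => (ν i : Measure (D.LocalPolicy i))).map f.push := by
  have hm : Measurable fun (π : D.Policy) i => f.pushLocal i (π i) :=
    measurable_pi_lambda _ fun i =>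
      (f.pushLocal i).continuous.measurable.comp (measurable_pi_apply i)
  rw [← Measure.pi_map_piCongrLeft f.fN]
  simp only [f.pushMixture_fN]
  rw [← Measure.pi_map_pi (fun i => (f.pushLocal i).continuous.aemeasurable),
    Measure.map_map (MeasurableEquiv.measurable _) hm]
  rfl

theorem mixProb_pushMixture (f : Iso D E) (ν : ∀ i, ProbabilityMeasure (D.LocalPolicy i))
    (Q : Set E.History) :
    E.mixProb (Measure.pi fun j => (f.pushMixture ν j : Measure (E.LocalPolicy j))) Q
      = D.mixProb (Measure.pi fun i => (ν i : Measure (D.LocalPolicy i))) (f.history ⁻¹' Q) := by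
  unfold mixProb
  rw [f.pi_pushMixture, integral_map f.continuous_push.aemeasurable
    (continuous_prob Q).aestronglyMeasurable]
  simp only [f.prob_push]

theorem history_preimage_reach (f : Iso D E) (i : Fin D.N) (τ : E.AOHist (f.fN i)) :
    f.history ⁻¹' E.reach (f.fN i) τ = D.reach i (f.invHist i τ) := by
  ext h
  change (f.history h).aoHist (f.fN i) τ.1 = τ ↔ h.aoHist i _ = f.invHist i τ
  rw [f.history_aoHist]
  constructor
  · intro e
    rw [← e, f.invHist_mapHist]
    rfl
  · intro e
    rw [← f.mapHist_invHist i τ, ← e]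
    rfl

theorem history_preimage_plays (f : Iso D E) (i : Fin D.N) (τ : E.AOHist (f.fN i))
    (a : E.Act (f.fN i)) :
    f.history ⁻¹' E.plays (f.fN i) τ a = D.plays i (f.invHist i τ) ((f.fA i).symm a) := by
  ext h
  simp only [Set.mem_preimage, plays, Set.mem_ofPred_eq, f.history_act,
    Equiv.piCongr_apply_apply, Equiv.eq_symm_apply]
  rfl

theorem witness_pushMixture_iff (f : Iso D E) (i : Fin D.N) (μ : Measure (D.LocalPolicy i))
    (τ : E.AOHist (f.fN i)) (ν : ∀ j, ProbabilityMeasure (D.LocalPolicy j)) :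
    E.Witness (f.fN i) (μ.map (f.pushLocal i)) τ (f.pushMixture ν)
      ↔ D.Witness i μ (f.invHist i τ) ν := by
  unfold Witness
  rw [f.mixProb_pushMixture, f.history_preimage_reach, f.pushMixture_fN]
  exact and_congr_left' (f.pushLocal i).toMeasurableEquiv.map_measurableEquiv_injective.eq_iff

theorem condPlay_pushMixture (f : Iso D E) (i : Fin D.N)
    (ν : ∀ j, ProbabilityMeasure (D.LocalPolicy j)) (τ : E.AOHist (f.fN i))
    (a : E.Act (f.fN i)) :
    condPlay (f.fN i) (f.pushMixture ν) τ a
      = condPlay i ν (f.invHist i τ) ((f.fA i).symm a) := by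
  rw [condPlay, condPlay, f.mixProb_pushMixture, f.mixProb_pushMixture, Set.preimage_inter,
    f.history_preimage_reach, f.history_preimage_plays]

theorem mixturePolicy_push (f : Iso D E) (hD : D.HasIndependentMixtures) (i : Fin D.N)
    (μ : Measure (D.LocalPolicy i)) (τ : E.AOHist (f.fN i)) (a : E.Act (f.fN i)) :
    E.mixturePolicy (f.fN i) (μ.map (f.pushLocal i)) τ a
      = D.mixturePolicy i μ (f.invHist i τ) ((f.fA i).symm a) := by
  by_cases hex : ∃ ν, D.Witness i μ (f.invHist i τ) ν
  · obtain ⟨ν, hν⟩ := hex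
    rw [hD.mixturePolicy_eq hν]
    refine mixturePolicy_eq_of_forall_condPlay_eq
      ⟨f.pushMixture ν, (f.witness_pushMixture_iff i μ τ ν).2 hν⟩ fun ν' hν' => ?_
    obtain ⟨ν', rfl⟩ := f.pushMixture_surjective ν'
    rw [f.condPlay_pushMixture, hD ((f.witness_pushMixture_iff i μ τ ν').1 hν') hν]
  · have hex' : ¬ ∃ ν', E.Witness (f.fN i) (μ.map (f.pushLocal i)) τ ν' := by
      simpa only [f.pushMixture_surjective.exists, f.witness_pushMixture_iff] using hex
    rw [mixturePolicy, mixturePolicy, dif_neg hex, dif_neg hex', Fintype.card_congr (f.fA i)]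

theorem symmetrizer_push (f : Iso D E) (hD : D.HasIndependentMixtures) (π : D.Policy)
    (i : Fin D.N) (τ : E.AOHist (f.fN i)) (a : E.Act (f.fN i)) :
    E.symmetrizer (f.push π) (f.fN i) τ a
      = D.symmetrizer π i (f.invHist i τ) ((f.fA i).symm a) := by
  rw [symmetrizer, symmetrizer, ← opMarginal, f.opMarginal_push, f.mixturePolicy_push hD,
    opMarginal]

theorem push_mem_opClass_push_iff (f : Iso D E) (hD : D.HasIndependentMixtures)
    {π π' : D.Policy} : f.push π ∈ E.opClass (f.push π') ↔ π ∈ D.opClass π' := by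
  constructor
  · intro h
    funext i τ a
    simpa only [f.symmetrizer_push hD, invHist_mapHist, Equiv.symm_apply_apply]
      using congrFun₃ h (f.fN i) (f.mapHist i τ) (f.fA i a)
  · intro h
    funext j τ a
    obtain ⟨i, rfl⟩ := f.fN.surjective j
    simp only [f.symmetrizer_push hD, show D.symmetrizer π = D.symmetrizer π' from h]

end Iso

end DecPOMDP

namespace LeverGame

open DecPOMDP

/-! ### Policies and return of the lever game -/

theorem pointDist_apply {X : Type} [Fintype X] [DecidableEq X] (x y : X) :
    pointDist x y = if y = x then 1 else 0 :=
  Pi.single_apply x (1 : ℝ) y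

/-- Local policies, which are the same for both agents. -/
abbrev LeverLocal : Type := leverGame.LocalPolicy 0

/-- The history before the first round. -/
abbrev emptyHist : leverGame.AOHist 0 := ⟨0, fun k => k.elim0⟩

/-- The history before the second round of an agent who played `a` and observed `o`. -/
abbrev oneHist (a o : Fin 2) : leverGame.AOHist 0 := ⟨1, fun _ => (a, o)⟩

theorem eq_emptyHist_or_eq_oneHist (τ : leverGame.AOHist 0) :
    τ = emptyHist ∨ ∃ a o, τ = oneHist a o := by
  obtain ⟨t, u⟩ := τ
  change Fin 2 at t
  fin_cases t
  · exact Or.inl (Sigma.ext rfl (heq_of_eq (funext fun k => k.elim0)))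
  · refine Or.inr ⟨(u 0).1, (u 0).2, Sigma.ext rfl (heq_of_eq (funext fun k => ?_))⟩
    change Fin 1 at k
    rw [Subsingleton.elim k 0]

/-- The probability of the first action `b`. -/
def firstProb (b : Fin 2) (p : LeverLocal) : ℝ := p emptyHist b

/-- The probability of the second action `b` after the own action `a` and the observation `o`. -/
def secondProb (a o b : Fin 2) (p : LeverLocal) : ℝ := p (oneHist a o) b

/-- The sign of a lever. The reward of a joint action is the product of the signs of its levers. -/
def leverSign : Fin 2 → ℝ := ![1, -1]

/-- The mean sign of the first action. -/
def firstBias (p : LeverLocal) : ℝ := firstProb 0 p - firstProb 1 p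

/-- The mean sign of the second action on the event that the first action is `a`, if `o` is
observed: the conditional mean is weighted with the probability of `a`. -/
def secondBias (a o : Fin 2) (p : LeverLocal) : ℝ :=
  firstProb a p * (secondProb a o 0 p - secondProb a o 1 p)

theorem firstProb_nonneg (b : Fin 2) (p : LeverLocal) : 0 ≤ firstProb b p :=
  stdSimplex.zero_le (p emptyHist) b

theorem secondProb_nonneg (a o b : Fin 2) (p : LeverLocal) : 0 ≤ secondProb a o b p :=
  stdSimplex.zero_le (p (oneHist a o)) b

theorem sum_firstProb (p : LeverLocal) : ∑ b, firstProb b p = 1 :=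
  (p emptyHist).2.2

theorem sum_secondProb (a o : Fin 2) (p : LeverLocal) : ∑ b, secondProb a o b p = 1 :=
  (p (oneHist a o)).2.2

theorem continuous_firstProb (b : Fin 2) : Continuous (firstProb b) :=
  (continuous_stdSimplex_apply (X := Fin 2) b).comp (continuous_apply emptyHist)

theorem continuous_secondProb (a o b : Fin 2) : Continuous (secondProb a o b) :=
  (continuous_stdSimplex_apply (X := Fin 2) b).comp (continuous_apply (oneHist a o))

theorem continuous_secondBias (a o : Fin 2) : Continuous (secondBias a o) :=
  (continuous_firstProb a).mul ((continuous_secondProb a o 0).sub (continuous_secondProb a o 1))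

theorem sum_firstProb_mul_leverSign (p : LeverLocal) :
    ∑ b, firstProb b p * leverSign b = firstBias p := by
  simp only [firstBias, leverSign, Fin.sum_univ_two, Matrix.cons_val_zero, Matrix.cons_val_one]
  ring

theorem firstProb_mul_sum_secondProb_mul_leverSign (a o : Fin 2) (p : LeverLocal) :
    firstProb a p * ∑ b, secondProb a o b p * leverSign b = secondBias a o p := by
  simp only [secondBias, leverSign, Fin.sum_univ_two, Matrix.cons_val_zero, Matrix.cons_val_one]
  ring

theorem firstProb_mul_secondProb (a o b : Fin 2) (p : LeverLocal) :
    firstProb a p * secondProb a o b p = (firstProb a p + leverSign b * secondBias a o p) / 2 := by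
  have h := sum_secondProb a o p
  rw [Fin.sum_univ_two, ← eq_sub_iff_add_eq'] at h
  fin_cases b <;> simp [leverSign, secondBias, h] <;> ring

theorem abs_secondBias_le (a o : Fin 2) (p : LeverLocal) : |secondBias a o p| ≤ firstProb a p := by
  have h0 := secondProb_nonneg a o 0 p
  have h1 := secondProb_nonneg a o 1 p
  have h := sum_secondProb a o p
  rw [Fin.sum_univ_two] at h
  rw [secondBias, abs_mul, abs_of_nonneg (firstProb_nonneg a p)]
  exact mul_le_of_le_one_right (firstProb_nonneg a p) (abs_le.2 ⟨by linarith, by linarith⟩)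

theorem leverGame_reward (s : Fin 1) (a : Fin 2 → Fin 2) :
    leverGame.reward s a = ∏ i, leverSign (a i) := by
  have h : ∀ x y : Fin 2, (if x = y then (1 : ℝ) else -1) = leverSign x * leverSign y := by
    intro x y
    fin_cases x <;> fin_cases y <;> simp [leverSign]
  rw [Fin.prod_univ_two]
  exact h (a 0) (a 1)

/-- The history in which the joint actions are `a` and `b`. -/
def leverHist (a b : Fin 2 → Fin 2) : leverGame.History :=
  (fun _ => 0, ![a, b], fun _ i => a i.rev)

theorem leverHist_aoHist_zero (a b : Fin 2 → Fin 2) (i : Fin 2) :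
    (leverHist a b).aoHist i 0 = emptyHist :=
  Sigma.ext rfl (heq_of_eq (funext fun k => k.elim0))

theorem leverHist_aoHist_one (a b : Fin 2 → Fin 2) (i : Fin 2) :
    (leverHist a b).aoHist i 1 = oneHist (a i) (a i.rev) := by
  refine Sigma.ext rfl (heq_of_eq (funext fun k => ?_))
  change Fin 1 at k
  rw [Subsingleton.elim k 0]
  rfl

theorem leverHist_injective : Function.Injective
    fun ab : (Fin 2 → Fin 2) × (Fin 2 → Fin 2) => leverHist ab.1 ab.2 := by
  rintro ⟨a, b⟩ ⟨a', b'⟩ h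
  have hact := congrArg (fun h : leverGame.History => h.2.1) h
  exact Prod.ext (congrFun hact 0) (congrFun hact 1)

theorem histProb_leverHist (π : leverGame.Policy) (a b : Fin 2 → Fin 2) :
    leverGame.histProb π (leverHist a b)
      = (∏ i, firstProb (a i) (π i)) * ∏ i, secondProb (a i) (a i.rev) (b i) (π i) := by
  have dynamics_eq_one : ∏ t : Fin leverGame.T,
      leverGame.trans ((leverHist a b).state t.castSucc) ((leverHist a b).act t.castSucc)
          ((leverHist a b).state t.succ)
        * leverGame.obsKer ((leverHist a b).state t.succ) ((leverHist a b).act t.castSucc)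
          ((leverHist a b).obs t) = 1 := by
    refine Finset.prod_eq_one fun t _ => ?_
    have hobs : (leverHist a b).obs t = fun i : Fin 2 => (leverHist a b).act t.castSucc i.rev := by
      rw [Subsingleton.elim (α := Fin 1) t 0]
      rfl
    rw [pointDist_apply, pointDist_apply, if_pos (Subsingleton.elim _ _), if_pos hobs, mul_one]
  have init_eq_one : leverGame.init ((leverHist a b).state 0) = 1 := by
    rw [pointDist_apply, if_pos (Subsingleton.elim _ _)]
  rw [histProb, dynamics_eq_one, init_eq_one, one_mul, one_mul]
  change ∏ t : Fin 2, ∏ i : Fin 2, _ = _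
  rw [Fin.prod_univ_two]
  simp only [leverHist_aoHist_zero, leverHist_aoHist_one]
  rfl

theorem histProb_eq_zero_of_notMem_range (π : leverGame.Policy) {h : leverGame.History}
    (hh : h ∉ Set.range fun ab : (Fin 2 → Fin 2) × (Fin 2 → Fin 2) => leverHist ab.1 ab.2) :
    leverGame.histProb π h = 0 := by
  have hobs : h.obs 0 ≠ fun i : Fin 2 => h.act 0 i.rev := by
    intro ho
    refine hh ⟨(h.act 0, h.act 1), Prod.ext (Subsingleton.elim _ _) (Prod.ext ?_ ?_)⟩
    · funext t
      change Fin 2 at t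
      fin_cases t <;> rfl
    · funext t
      change Fin 1 at t
      rw [Subsingleton.elim t 0]
      exact ho.symm
  have obsKer_eq_zero : leverGame.obsKer (h.state 1) (h.act 0) (h.obs 0) = 0 := by
    rw [pointDist_apply, if_neg hobs]
  have dynamics_eq_zero : ∏ t : Fin leverGame.T,
      leverGame.trans (h.state t.castSucc) (h.act t.castSucc) (h.state t.succ)
        * leverGame.obsKer (h.state t.succ) (h.act t.castSucc) (h.obs t) = 0 :=
    Finset.prod_eq_zero (Finset.mem_univ 0) (mul_eq_zero_of_right _ obsKer_eq_zero)
  rw [histProb, dynamics_eq_zero, mul_zero, zero_mul]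

theorem sum_histProb_mul (π : leverGame.Policy) (F : leverGame.History → ℝ) :
    ∑ h, leverGame.histProb π h * F h = ∑ a : Fin 2 → Fin 2, (∏ i, firstProb (a i) (π i)) *
      ∑ b : Fin 2 → Fin 2, (∏ i, secondProb (a i) (a i.rev) (b i) (π i)) * F (leverHist a b) := by
  simp only [Finset.mul_sum, ← mul_assoc, ← histProb_leverHist]
  rw [← Fintype.sum_prod_type' (f := fun a b : Fin 2 → Fin 2 =>
    leverGame.histProb π (leverHist a b) * F (leverHist a b))]
  refine (Fintype.sum_of_injective _ leverHist_injective _ _ (fun h hh => ?_) fun _ => rfl).symm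
  rw [histProb_eq_zero_of_notMem_range π hh, zero_mul]

theorem sum_prod_secondProb (π : leverGame.Policy) (a : Fin 2 → Fin 2) :
    ∑ b : Fin 2 → Fin 2, ∏ i, secondProb (a i) (a i.rev) (b i) (π i) = 1 := by
  rw [← Fintype.prod_sum fun i b => secondProb (a i) (a i.rev) b (π i)]
  exact Finset.prod_eq_one fun i _ => sum_secondProb _ _ _

/-- The factor of agent `i` in the terms of the expected return: the term `none` is the expected
reward of the first round, and `some a` is that of the second round on the event that the first
joint action is `a`. -/
def returnFactor : Option (Fin 2 → Fin 2) → Fin 2 → LeverLocal → ℝ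
  | none, _ => firstBias
  | some a, i => secondBias (a i) (a i.rev)

theorem continuous_returnFactor (c : Option (Fin 2 → Fin 2)) (i : Fin 2) :
    Continuous (returnFactor c i) := by
  cases c with
  | none => exact (continuous_firstProb 0).sub (continuous_firstProb 1)
  | some a => exact continuous_secondBias _ _

theorem J_eq_sum_prod (π : leverGame.Policy) :
    leverGame.J π = ∑ c, ∏ i, returnFactor c i (π i) := by
  have total_reward (a b : Fin 2 → Fin 2) :
      ∑ t, leverGame.reward ((leverHist a b).state t) ((leverHist a b).act t)
        = ∏ i, leverSign (a i) + ∏ i, leverSign (b i) := by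
    change ∑ t : Fin 2, _ = _
    rw [Fin.sum_univ_two, leverGame_reward, leverGame_reward]
    rfl
  have first_round : ∑ a : Fin 2 → Fin 2,
      (∏ i, firstProb (a i) (π i)) * ∏ i, leverSign (a i) = ∏ i, firstBias (π i) := by
    simp only [← Finset.prod_mul_distrib, ← sum_firstProb_mul_leverSign]
    exact (Fintype.prod_sum fun i b => firstProb b (π i) * leverSign b).symm
  have second_round (a : Fin 2 → Fin 2) :
      (∏ i, firstProb (a i) (π i)) * ∑ b : Fin 2 → Fin 2,
          (∏ i, secondProb (a i) (a i.rev) (b i) (π i)) * ∏ i, leverSign (b i)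
        = ∏ i, secondBias (a i) (a i.rev) (π i) := by
    simp only [← Finset.prod_mul_distrib, ← firstProb_mul_sum_secondProb_mul_leverSign]
    rw [Finset.prod_mul_distrib,
      Fintype.prod_sum fun i b => secondProb (a i) (a i.rev) b (π i) * leverSign b]
  rw [J, sum_histProb_mul, Fintype.sum_option]
  simp only [total_reward, mul_add, Finset.sum_add_distrib, ← Finset.sum_mul, sum_prod_secondProb,
    one_mul, second_round, first_round, returnFactor]

/-! ### Symmetries of the lever game -/

/-- The automorphism that permutes the agents by `s` and the levers by `t`. -/
def leverAut (s t : Equiv.Perm (Fin 2)) : leverGame.Aut where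
  fN := s
  fS := Equiv.refl _
  fA _ := t
  fO _ := t
  horizon := rfl
  trans_eq _ _ _ := rfl
  obs_eq _ a o := by
    rw [pointDist_apply, pointDist_apply]
    refine if_congr ?_ rfl rfl
    simp only [funext_iff]
    refine s.forall_congr fun {i} => ?_
    rw [← perm_finTwo_rev, Equiv.piCongr_apply_apply, Equiv.piCongr_apply_apply, t.injective.eq_iff]
  reward_eq _ a := by
    refine if_congr ?_ rfl rfl
    rw [← apply_perm_finTwo_eq_iff s (Equiv.piCongr s (fun _ => t) a), Equiv.piCongr_apply_apply,
      Equiv.piCongr_apply_apply, t.injective.eq_iff]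
  init_eq _ := rfl

theorem aut_fA_eq (g : leverGame.Aut) (i : Fin 2) : g.fA i = g.fA 0 := by
  have fA_one : g.fA 1 = g.fA 0 := by
    ext x : 1
    have h : (1 : ℝ) = ite _ _ _ := (if_pos rfl).symm.trans (g.reward_eq 0 fun _ => x)
    have same_lever := (ite_ne_right_iff.1 (h.symm.trans_ne (by norm_num))).1
    rw [← apply_perm_finTwo_eq_iff g.fN, Equiv.piCongr_apply_apply, Equiv.piCongr_apply_apply]
      at same_lever
    exact same_lever.symm
  fin_cases i
  · rfl
  · exact fA_one

theorem aut_fO_eq (g : leverGame.Aut) (i : Fin 2) : g.fO i = g.fA 0 := by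
  ext x : 1
  have h := g.obs_eq 0 (fun _ => x) fun _ => x
  rw [pointDist_apply, pointDist_apply, if_pos rfl] at h
  have obs_eq_act := congrFun (ite_ne_right_iff.1 (h.symm.trans_ne one_ne_zero)).1 (g.fN i)
  rwa [← perm_finTwo_rev, Equiv.piCongr_apply_apply, Equiv.piCongr_apply_apply, aut_fA_eq]
    at obs_eq_act

theorem invHist_emptyHist (g : leverGame.Aut) (i : Fin 2) : g.invHist i emptyHist = emptyHist :=
  Sigma.ext rfl (heq_of_eq (funext fun k => k.elim0))

theorem invHist_oneHist (g : leverGame.Aut) (i a o : Fin 2) :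
    g.invHist i (oneHist a o) = oneHist ((g.fA i).symm a) ((g.fO i).symm o) := rfl

theorem leverPolicy_emptyHist (r : Fin 2 → Fin 2) (i b : Fin 2) :
    leverPolicy r i emptyHist b = 1 / 2 := rfl

theorem leverPolicy_oneHist (r : Fin 2 → Fin 2) (i a o b : Fin 2) :
    leverPolicy r i (oneHist a o) b = if a = o then if b = r a then 1 else 0 else 1 / 2 := by
  change (if a = o then pointDist (r a) else uniformLever) b = _
  split_ifs with h hb
  · rw [pointDist_apply, if_pos hb]
  · rw [pointDist_apply, if_neg hb]
  · rfl

theorem push_leverPolicy {r : Fin 2 → Fin 2} (hr : ∀ (t : Equiv.Perm (Fin 2)) a, r (t a) = t (r a))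
    (g : leverGame.Aut) : g.push (leverPolicy r) = leverPolicy r := by
  funext j
  obtain ⟨i, rfl⟩ := g.fN.surjective j
  funext τ
  ext b
  rw [g.push_fN, g.pushLocal_apply]
  rcases eq_emptyHist_or_eq_oneHist τ with rfl | ⟨a, o, rfl⟩
  · rfl
  · rw [invHist_oneHist, aut_fA_eq, aut_fO_eq, leverPolicy_oneHist, leverPolicy_oneHist, hr]
    simp only [Equiv.apply_eq_iff_eq]

/-! ### Biases averaged over symmetries -/

/-- The local policy with the two levers exchanged. -/
def flipLocal : LeverLocal → LeverLocal := (leverAut 1 Fin.revPerm).pushLocal 0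

theorem firstProb_flipLocal (b : Fin 2) (p : LeverLocal) :
    firstProb b (flipLocal p) = firstProb b.rev p := by
  rw [firstProb, flipLocal, Iso.pushLocal_apply, invHist_emptyHist]
  rfl

theorem secondBias_flipLocal (a o : Fin 2) (p : LeverLocal) :
    secondBias a o (flipLocal p) = -secondBias a.rev o.rev p := by
  have secondProb_flipLocal (b : Fin 2) :
      secondProb a o b (flipLocal p) = secondProb a.rev o.rev b.rev p := rfl
  rw [secondBias, secondBias, firstProb_flipLocal, secondProb_flipLocal, secondProb_flipLocal,
    ← mul_neg, neg_sub]
  rfl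

variable {E : DecPOMDP}

/-- The average of `G` over the local policies of a fixed agent of the lever game under the
pushforwards of `ρ`. By symmetry the agent does not matter, see `isoMean_eq_leverMean`. -/
noncomputable abbrev leverMean (G : LeverLocal → ℝ) (ρ : E.Policy) : ℝ :=
  isoMean (D := leverGame) 0 G ρ

theorem isoMean_eq_leverMean (i : Fin 2) (G : LeverLocal → ℝ) (ρ : E.Policy) :
    isoMean (D := leverGame) i G ρ = leverMean G ρ := by
  obtain ⟨s, rfl⟩ : ∃ s : Equiv.Perm (Fin 2), s 0 = i := ⟨Equiv.swap 0 i, Equiv.swap_apply_left 0 i⟩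
  have pushLocal_eq_self (p : LeverLocal) : (leverAut s 1).pushLocal 0 p = p := by
    funext τ
    ext b
    rw [Iso.pushLocal_apply]
    rcases eq_emptyHist_or_eq_oneHist τ with rfl | ⟨a, o, rfl⟩
    · rw [invHist_emptyHist]
      rfl
    · rfl
  have h := isoMean_comp_pushLocal (leverAut s 1) 0 G ρ
  simp only [pushLocal_eq_self] at h
  exact h.symm

theorem leverMean_comp_flipLocal (G : LeverLocal → ℝ) (ρ : E.Policy) :
    leverMean (fun p => G (flipLocal p)) ρ = leverMean G ρ :=
  isoMean_comp_pushLocal (leverAut 1 Fin.revPerm) 0 G ρ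

theorem leverMean_firstProb_one (ρ : E.Policy) :
    leverMean (firstProb 1) ρ = leverMean (firstProb 0) ρ := by
  rw [← leverMean_comp_flipLocal]
  simp only [firstProb_flipLocal]
  rfl

theorem leverMean_firstBias (ρ : E.Policy) : leverMean firstBias ρ = 0 :=
  (Finset.expect_sub_distrib _ _ _).trans (sub_eq_zero.2 (leverMean_firstProb_one ρ).symm)

theorem leverMean_firstProb (b : Fin 2) (π : leverGame.Policy) :
    leverMean (firstProb b) π = 1 / 2 := by
  have sum_leverMean : ∑ b, leverMean (firstProb b) π = 1 := by
    simp only [leverMean, isoMean, ← Finset.expect_sum_comm, sum_firstProb]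
    exact Finset.expect_const Finset.univ_nonempty 1
  rw [Fin.sum_univ_two] at sum_leverMean
  have h := leverMean_firstProb_one π
  fin_cases b <;> dsimp only [Fin.zero_eta, Fin.mk_one] <;> linarith

/-- The mean sign of the second action, conditioned on the own first action `a` and the observation
`o` and averaged over the symmetries of the lever game. The factor `2` is the inverse of the mean
probability of the first action `a`. By antisymmetry, `symBias 0 0` and `symBias 0 1` determine
all values: they measure how much agents tend to repeat their action after equal and after
different first actions. -/
noncomputable def symBias (a o : Fin 2) (ρ : E.Policy) : ℝ := 2 * leverMean (secondBias a o) ρ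

theorem symBias_rev (a o : Fin 2) (ρ : E.Policy) :
    symBias a.rev o.rev ρ = -symBias a o ρ := by
  rw [symBias, symBias, ← leverMean_comp_flipLocal]
  simp only [secondBias_flipLocal, Fin.rev_rev]
  rw [leverMean, isoMean, Finset.expect_neg_distrib, mul_neg]
  rfl

theorem isoMean_secondBias (i a o : Fin 2) (ρ : E.Policy) :
    isoMean (D := leverGame) i (secondBias a o) ρ = symBias a o ρ / 2 := by
  rw [isoMean_eq_leverMean, symBias, mul_div_cancel_left₀ _ two_ne_zero]

theorem continuous_symBias (a o : Fin 2) : Continuous (symBias a o : E.Policy → ℝ) :=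
  continuous_const.mul (continuous_isoMean (continuous_secondBias a o))

theorem symBias_push {F : DecPOMDP} (f : Iso E F) (a o : Fin 2) (ρ : E.Policy) :
    symBias a o (f.push ρ) = symBias a o ρ := by
  rw [symBias, leverMean, isoMean_push, symBias]

theorem abs_symBias_le_one (a o : Fin 2) (π : leverGame.Policy) : |symBias a o π| ≤ 1 := by
  have abs_leverMean_le : |leverMean (secondBias a o) π| ≤ leverMean (firstProb a) π :=
    (Finset.abs_expect_le _ _).trans (Finset.expect_le_expect fun h _ => abs_secondBias_le a o _)
  rw [leverMean_firstProb] at abs_leverMean_le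
  rw [symBias, abs_mul, abs_two]
  linarith

/-! ### Other-play and label-free coordination values -/

theorem sum_prod_of_antisymm {B : Fin 2 → Fin 2 → ℝ} (hB : ∀ a o, B a.rev o.rev = -B a o) :
    ∑ u : Fin 2 → Fin 2, ∏ i, B (u i) (u i.rev) = 2 * (B 0 0 ^ 2 - B 0 1 ^ 2) := by
  have h11 : B 1 1 = -B 0 0 := hB 0 0
  have h10 : B 1 0 = -B 0 1 := hB 0 1
  simp only [Fin.prod_univ_two]
  refine (sum_finTwo_fun (fun x y => B x y * B y x) 0).trans ?_
  simp only [Fin.sum_univ_two, h11, h10]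
  ring

theorem JOP_eq (π : leverGame.Policy) :
    leverGame.JOP π = (symBias 0 0 π ^ 2 - symBias 0 1 π ^ 2) / 2 := by
  have first_round : ∏ i : Fin 2, isoMean (D := leverGame) i firstBias π = 0 :=
    Finset.prod_eq_zero (Finset.mem_univ 0) (leverMean_firstBias π)
  rw [JOP_eq_sum_prod_isoMean J_eq_sum_prod, Fintype.sum_option]
  simp only [returnFactor, first_round, isoMean_secondBias, zero_add]
  refine (sum_prod_of_antisymm (B := fun a o => symBias a o π / 2) fun a o => ?_).trans ?_
  · rw [symBias_rev, neg_div]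
  · ring

/-- The mean bias of the policies learned by `σ` on a uniformly random relabeled problem. -/
noncomputable def learnedBias (σ : LearningAlg leverGame.relabelings) (a o : Fin 2) : ℝ :=
  𝔼 E : leverGame.relabelings, ∫ ρ, symBias a o ρ ∂(σ E : Measure (Policy (E : DecPOMDP)))

theorem learnedBias_rev (σ : LearningAlg leverGame.relabelings) (a o : Fin 2) :
    learnedBias σ a.rev o.rev = -learnedBias σ a o := by
  simp only [learnedBias, symBias_rev, integral_neg, Finset.expect_neg_distrib]

theorem lfcValue_eq (σ : LearningAlg leverGame.relabelings) :
    leverGame.lfcValue σ = (learnedBias σ 0 0 ^ 2 - learnedBias σ 0 1 ^ 2) / 2 := by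
  have first_round : ∏ i : Fin 2, 𝔼 E : leverGame.relabelings, ∫ ρ,
      isoMean (D := leverGame) i firstBias ρ ∂(σ E : Measure (Policy (E : DecPOMDP))) = 0 := by
    refine Finset.prod_eq_zero (Finset.mem_univ 0) ?_
    simp only [leverMean_firstBias, integral_zero, Finset.expect_const_zero]
  rw [lfcValue_eq_sum_prod_isoMean J_eq_sum_prod continuous_returnFactor, Fintype.sum_option]
  simp only [returnFactor, first_round, isoMean_secondBias, zero_add, integral_div,
    ← Finset.expect_div]
  refine (sum_prod_of_antisymm (B := fun a o => learnedBias σ a o / 2) fun a o => ?_).trans ?_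
  · rw [learnedBias_rev, neg_div]
  · ring

/-! ### The policies `policyR` and `policyS` -/

theorem firstBias_leverPolicy (r : Fin 2 → Fin 2) (i : Fin 2) : firstBias (leverPolicy r i) = 0 :=
  sub_self _

theorem secondBias_leverPolicy (r : Fin 2 → Fin 2) (i a o : Fin 2) :
    secondBias a o (leverPolicy r i) = if a = o then leverSign (r a) / 2 else 0 := by
  rw [secondBias, firstProb, secondProb, secondProb, leverPolicy_emptyHist, leverPolicy_oneHist,
    leverPolicy_oneHist]
  have sign_eq (b : Fin 2) : leverSign b = (if 0 = b then 1 else 0) - if 1 = b then 1 else 0 := by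
    fin_cases b <;> simp [leverSign]
  by_cases h : a = o
  · simp only [if_pos h, sign_eq]
    ring
  · simp only [if_neg h]
    ring

theorem symBias_leverPolicy {r : Fin 2 → Fin 2}
    (hr : ∀ (t : Equiv.Perm (Fin 2)) a, r (t a) = t (r a)) (a o : Fin 2) :
    symBias a o (leverPolicy r) = if a = o then leverSign (r a) else 0 := by
  simp only [symBias, leverMean, isoMean, push_leverPolicy hr]
  rw [Finset.expect_const Finset.univ_nonempty, secondBias_leverPolicy]
  split_ifs <;> ring

theorem symBias_policyR (a o : Fin 2) :
    symBias a o policyR = if a = o then leverSign a else 0 :=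
  symBias_leverPolicy (fun _ _ => rfl) a o

theorem leverSign_rev (a : Fin 2) : leverSign a.rev = -leverSign a := by
  fin_cases a <;> simp [leverSign, Fin.rev]

theorem symBias_policyS (a o : Fin 2) :
    symBias a o policyS = if a = o then -leverSign a else 0 := by
  rw [← leverSign_rev]
  exact symBias_leverPolicy (fun t a => (perm_finTwo_rev t a).symm) a o

theorem J_leverPolicy_leverPolicy (r r' : Fin 2 → Fin 2) :
    leverGame.J (fun i => if i = 0 then leverPolicy r i else leverPolicy r' i)
      = (leverSign (r 0) * leverSign (r' 0) + leverSign (r 1) * leverSign (r' 1)) / 4 := by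
  rw [J_eq_sum_prod, Fintype.sum_option]
  simp only [returnFactor, Fin.prod_univ_two, if_true, if_neg one_ne_zero, firstBias_leverPolicy,
    zero_mul, zero_add]
  refine (sum_finTwo_fun (fun x y => secondBias x y (leverPolicy r 0)
    * secondBias y x (leverPolicy r' 1)) 0).trans ?_
  simp only [secondBias_leverPolicy, Fin.sum_univ_two, if_true, if_neg one_ne_zero,
    if_neg zero_ne_one]
  ring

theorem J_policyR_policyS :
    leverGame.J (fun i => if i = 0 then policyR i else policyS i) = -1 / 2 := by
  refine (J_leverPolicy_leverPolicy id Fin.rev).trans ?_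
  rw [leverSign_rev, leverSign_rev]
  norm_num [leverSign]

theorem J_policyS_policyR :
    leverGame.J (fun i => if i = 0 then policyS i else policyR i) = -1 / 2 := by
  refine (J_leverPolicy_leverPolicy Fin.rev id).trans ?_
  rw [leverSign_rev, leverSign_rev]
  norm_num [leverSign]

/-! ### The symmetrizer of the lever game -/

theorem sum_secondProb_ite (π : leverGame.Policy) (i : Fin 2) (u : Fin 2 → Fin 2)
    (R : Fin 2 → Prop) [DecidablePred R] :
    ∑ v : Fin 2 → Fin 2, (∏ j, secondProb (u j) (u j.rev) (v j) (π j)) * (if R (v i) then 1 else 0)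
      = ∑ z, if R z then secondProb (u i) (u i.rev) z (π i) else 0 := by
  simp only [prod_finTwo_eq_mul_rev _ i, Fin.rev_rev]
  refine (sum_finTwo_fun (fun z w => secondProb (u i) (u i.rev) z (π i)
    * secondProb (u i.rev) (u i) w (π i.rev) * if R z then 1 else 0) i).trans ?_
  refine Finset.sum_congr rfl fun z _ => ?_
  rw [← Finset.sum_mul, ← Finset.mul_sum, sum_secondProb, mul_one, mul_ite, mul_one, mul_zero]

theorem prob_eq_sum_ite (π : leverGame.Policy) (i : Fin 2) {Q : Set leverGame.History}
    {R : Fin 2 → Fin 2 → Fin 2 → Prop} [∀ x y, DecidablePred (R x y)]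
    (hQ : ∀ u v, leverHist u v ∈ Q ↔ R (u i) (u i.rev) (v i)) :
    leverGame.prob π Q = ∑ x, ∑ y, firstProb x (π i) * firstProb y (π i.rev)
      * ∑ z, if R x y z then secondProb x y z (π i) else 0 := by
  classical
  have indicator_eq (h : leverGame.History) : Q.indicator (leverGame.histProb π) h
      = leverGame.histProb π h * if h ∈ Q then 1 else 0 := by
    rw [Set.indicator_apply, mul_ite, mul_one, mul_zero]
  simp only [prob, indicator_eq]
  rw [sum_histProb_mul]
  simp only [hQ, sum_secondProb_ite π i]
  simp only [prod_finTwo_eq_mul_rev _ i]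
  exact sum_finTwo_fun (fun x y => firstProb x (π i) * firstProb y (π i.rev)
    * ∑ z, if R x y z then secondProb x y z (π i) else 0) i

theorem leverHist_mem_reach_emptyHist (u v : Fin 2 → Fin 2) (i : Fin 2) :
    leverHist u v ∈ leverGame.reach i emptyHist :=
  leverHist_aoHist_zero u v i

theorem leverHist_mem_reach_oneHist_iff (u v : Fin 2 → Fin 2) (i a o : Fin 2) :
    leverHist u v ∈ leverGame.reach i (oneHist a o) ↔ u i = a ∧ u i.rev = o := by
  change (leverHist u v).aoHist i 1 = _ ↔ _
  rw [leverHist_aoHist_one]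
  constructor
  · intro h
    have entry_eq := congrFun (eq_of_heq (Sigma.mk.inj h).2) (0 : Fin 1)
    exact Prod.mk.inj entry_eq
  · rintro ⟨rfl, rfl⟩
    rfl

theorem leverHist_mem_plays_emptyHist_iff (u v : Fin 2 → Fin 2) (i b : Fin 2) :
    leverHist u v ∈ leverGame.plays i emptyHist b ↔ u i = b := Iff.rfl

theorem leverHist_mem_plays_oneHist_iff (u v : Fin 2 → Fin 2) (i a o b : Fin 2) :
    leverHist u v ∈ leverGame.plays i (oneHist a o) b ↔ v i = b := Iff.rfl

theorem prob_reach_emptyHist (π : leverGame.Policy) (i : Fin 2) :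
    leverGame.prob π (leverGame.reach i emptyHist) = 1 := by
  rw [prob_eq_sum_ite π i (R := fun _ _ _ => True) fun u v =>
    iff_true_intro (leverHist_mem_reach_emptyHist u v i)]
  simp only [if_true, sum_secondProb, mul_one, ← Finset.mul_sum, sum_firstProb]

theorem prob_plays_inter_reach_emptyHist (π : leverGame.Policy) (i b : Fin 2) :
    leverGame.prob π (leverGame.plays i emptyHist b ∩ leverGame.reach i emptyHist)
      = firstProb b (π i) := by
  rw [prob_eq_sum_ite π i (R := fun x _ _ => x = b) fun u v => by
    rw [Set.mem_inter_iff, leverHist_mem_plays_emptyHist_iff,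
      and_iff_left (leverHist_mem_reach_emptyHist u v i)]]
  simp only [Finset.sum_ite_irrel, Finset.sum_const_zero, sum_secondProb, mul_ite, mul_one,
    mul_zero, Finset.sum_ite_eq', Finset.mem_univ, if_true, ← Finset.mul_sum, sum_firstProb]

theorem prob_reach_oneHist (π : leverGame.Policy) (i a o : Fin 2) :
    leverGame.prob π (leverGame.reach i (oneHist a o))
      = firstProb a (π i) * firstProb o (π i.rev) := by
  rw [prob_eq_sum_ite π i (R := fun x y _ => x = a ∧ y = o) fun u v =>
    leverHist_mem_reach_oneHist_iff u v i a o]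
  simp only [ite_and, Finset.sum_ite_irrel, Finset.sum_const_zero, sum_secondProb, mul_ite,
    mul_one, mul_zero, Finset.sum_ite_eq', Finset.mem_univ, if_true]

theorem prob_plays_inter_reach_oneHist (π : leverGame.Policy) (i a o b : Fin 2) :
    leverGame.prob π (leverGame.plays i (oneHist a o) b ∩ leverGame.reach i (oneHist a o))
      = firstProb a (π i) * secondProb a o b (π i) * firstProb o (π i.rev) := by
  rw [prob_eq_sum_ite π i (R := fun x y z => (x = a ∧ y = o) ∧ z = b) fun u v => by
    rw [Set.mem_inter_iff, leverHist_mem_plays_oneHist_iff, leverHist_mem_reach_oneHist_iff,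
      and_comm]]
  simp only [ite_and, Finset.sum_ite_irrel, Finset.sum_const_zero, mul_ite,
    mul_zero, Finset.sum_ite_eq', Finset.mem_univ, if_true]
  exact mul_right_comm _ _ _

section Mixtures

variable (ν : ∀ j, ProbabilityMeasure (leverGame.LocalPolicy j))

theorem mixProb_reach_emptyHist (i : Fin 2) :
    leverGame.mixProb (Measure.pi fun j => (ν j : Measure (leverGame.LocalPolicy j)))
      (leverGame.reach i emptyHist) = 1 := by
  simp only [mixProb, prob_reach_emptyHist, integral_const, probReal_univ, one_smul]

theorem mixProb_reach_oneHist (i a o : Fin 2) :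
    leverGame.mixProb (Measure.pi fun j => (ν j : Measure (leverGame.LocalPolicy j)))
        (leverGame.reach i (oneHist a o))
      = (∫ p, firstProb a p ∂(ν i : Measure (leverGame.LocalPolicy i)))
        * ∫ p, firstProb o p ∂(ν i.rev : Measure (leverGame.LocalPolicy i.rev)) := by
  simp only [mixProb, prob_reach_oneHist]
  exact integral_pi_mul (finTwo_ne_rev i) (continuous_firstProb a).aestronglyMeasurable
    (continuous_firstProb o).aestronglyMeasurable

theorem condPlay_emptyHist (i b : Fin 2) :
    condPlay i ν emptyHist b = ∫ p, firstProb b p ∂(ν i : Measure (leverGame.LocalPolicy i)) := by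
  rw [condPlay, mixProb_reach_emptyHist, div_one]
  simp only [mixProb, prob_plays_inter_reach_emptyHist]
  exact integral_comp_eval (continuous_firstProb b).aestronglyMeasurable

variable {ν}

theorem condPlay_oneHist {i a o : Fin 2}
    (hν : 0 < leverGame.mixProb (Measure.pi fun j => (ν j : Measure (leverGame.LocalPolicy j)))
      (leverGame.reach i (oneHist a o))) (b : Fin 2) :
    condPlay i ν (oneHist a o) b
      = (∫ p, firstProb a p * secondProb a o b p ∂(ν i : Measure (leverGame.LocalPolicy i)))
        / ∫ p, firstProb a p ∂(ν i : Measure (leverGame.LocalPolicy i)) := by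
  have mixProb_inter :
      leverGame.mixProb (Measure.pi fun j => (ν j : Measure (leverGame.LocalPolicy j)))
        (leverGame.plays i (oneHist a o) b ∩ leverGame.reach i (oneHist a o))
      = (∫ p, firstProb a p * secondProb a o b p ∂(ν i : Measure (leverGame.LocalPolicy i)))
        * ∫ p, firstProb o p ∂(ν i.rev : Measure (leverGame.LocalPolicy i.rev)) := by
    simp only [mixProb, prob_plays_inter_reach_oneHist]
    exact integral_pi_mul (X := leverGame.LocalPolicy) (finTwo_ne_rev i)
      ((continuous_firstProb a).mul (continuous_secondProb a o b)).aestronglyMeasurable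
      (continuous_firstProb o).aestronglyMeasurable
  rw [mixProb_reach_oneHist] at hν
  rw [condPlay, mixProb_inter, mixProb_reach_oneHist,
    mul_div_mul_right _ _ (right_ne_zero_of_mul hν.ne')]

end Mixtures

theorem hasIndependentMixtures_leverGame : leverGame.HasIndependentMixtures := by
  intro i μ τ ν ν' hν hν'
  funext b
  rcases eq_emptyHist_or_eq_oneHist τ with rfl | ⟨a, o, rfl⟩
  · rw [condPlay_emptyHist, condPlay_emptyHist, hν.1, hν'.1]
  · rw [condPlay_oneHist hν.2, condPlay_oneHist hν'.2, hν.1, hν'.1]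

theorem integral_firstProb_opMarginal (π : leverGame.Policy) (i b : Fin 2) :
    ∫ p, firstProb b p ∂opMarginal π i = 1 / 2 := by
  rw [← leverMean_firstProb b π, ← isoMean_eq_leverMean i]
  exact integral_opMarginal π i (continuous_firstProb b)

theorem integral_firstProb_mul_secondProb_opMarginal (π : leverGame.Policy) (i a o b : Fin 2) :
    ∫ p, firstProb a p * secondProb a o b p ∂opMarginal π i
      = (1 + leverSign b * symBias a o π) / 4 := by
  have hfirst : Integrable (firstProb a) (opMarginal π i) :=
    integrable_of_continuous (continuous_firstProb a)
  have hsecond : Integrable (fun p => leverSign b * secondBias a o p) (opMarginal π i) :=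
    (integrable_of_continuous (continuous_secondBias a o)).const_mul _
  have integral_secondBias : ∫ p, secondBias a o p ∂opMarginal π i = symBias a o π / 2 := by
    rw [← isoMean_secondBias i]
    exact integral_opMarginal π i (continuous_secondBias a o)
  simp only [firstProb_mul_secondProb]
  rw [integral_div, integral_add hfirst hsecond, integral_const_mul, integral_secondBias,
    integral_firstProb_opMarginal]
  ring

/-- The marginals of the other-play distribution. -/
noncomputable abbrev opMarginals (π : leverGame.Policy) (j : Fin leverGame.N) :
    ProbabilityMeasure (leverGame.LocalPolicy j) := ⟨opMarginal π j, inferInstance⟩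

theorem witness_opMarginals (π : leverGame.Policy) (i : Fin 2) (τ : leverGame.AOHist i) :
    leverGame.Witness i (opMarginal π i) τ (opMarginals π) := by
  refine ⟨rfl, ?_⟩
  rcases eq_emptyHist_or_eq_oneHist τ with rfl | ⟨a, o, rfl⟩
  · rw [mixProb_reach_emptyHist]
    exact one_pos
  · rw [mixProb_reach_oneHist]
    simp only [ProbabilityMeasure.coe_mk, integral_firstProb_opMarginal]
    norm_num

theorem symmetrizer_emptyHist (π : leverGame.Policy) (i b : Fin 2) :
    leverGame.symmetrizer π i emptyHist b = 1 / 2 := by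
  rw [symmetrizer, ← opMarginal,
    hasIndependentMixtures_leverGame.mixturePolicy_eq (witness_opMarginals π i emptyHist),
    condPlay_emptyHist]
  exact integral_firstProb_opMarginal π i b

theorem symmetrizer_oneHist (π : leverGame.Policy) (i a o b : Fin 2) :
    leverGame.symmetrizer π i (oneHist a o) b = (1 + leverSign b * symBias a o π) / 2 := by
  have hν := witness_opMarginals π i (oneHist a o)
  rw [symmetrizer, ← opMarginal, hasIndependentMixtures_leverGame.mixturePolicy_eq hν,
    condPlay_oneHist hν.2]
  simp only [ProbabilityMeasure.coe_mk, integral_firstProb_opMarginal,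
    integral_firstProb_mul_secondProb_opMarginal]
  ring

theorem mem_opClass_iff_forall {π π' : leverGame.Policy} :
    π ∈ leverGame.opClass π' ↔ ∀ a o, symBias a o π = symBias a o π' := by
  constructor
  · intro h a o
    have probs_eq := congrFun₃ h 0 (oneHist a o) 0
    rw [symmetrizer_oneHist, symmetrizer_oneHist] at probs_eq
    simpa [leverSign] using probs_eq
  · intro h
    funext i τ b
    rcases eq_emptyHist_or_eq_oneHist τ with rfl | ⟨a, o, rfl⟩
    · rw [symmetrizer_emptyHist, symmetrizer_emptyHist]
    · rw [symmetrizer_oneHist, symmetrizer_oneHist, h]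

theorem mem_opClass_iff {π π' : leverGame.Policy} : π ∈ leverGame.opClass π' ↔
    symBias 0 0 π = symBias 0 0 π' ∧ symBias 0 1 π = symBias 0 1 π' := by
  have symBias_one_one (ρ : leverGame.Policy) : symBias 1 1 ρ = -symBias 0 0 ρ := symBias_rev 0 0 ρ
  have symBias_one_zero (ρ : leverGame.Policy) : symBias 1 0 ρ = -symBias 0 1 ρ := symBias_rev 0 1 ρ
  simp only [mem_opClass_iff_forall, Fin.forall_fin_two, symBias_one_one, symBias_one_zero,
    neg_inj]
  tauto

theorem mem_opClass_policyR_iff {π : leverGame.Policy} :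
    π ∈ leverGame.opClass policyR ↔ symBias 0 0 π = 1 ∧ symBias 0 1 π = 0 := by
  simp [mem_opClass_iff, symBias_policyR, leverSign]

theorem mem_opClass_policyS_iff {π : leverGame.Policy} :
    π ∈ leverGame.opClass policyS ↔ symBias 0 0 π = -1 ∧ symBias 0 1 π = 0 := by
  simp [mem_opClass_iff, symBias_policyS, leverSign]

theorem opClass_policyR_ne_opClass_policyS :
    leverGame.opClass policyR ≠ leverGame.opClass policyS := by
  intro h
  have mem_R : policyR ∈ leverGame.opClass policyR := rfl
  have bias_one := (mem_opClass_policyR_iff.1 mem_R).1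
  have bias_neg_one := (mem_opClass_policyS_iff.1 (h ▸ mem_R)).1
  linarith

theorem JOP_le_half (π : leverGame.Policy) : leverGame.JOP π ≤ 1 / 2 := by
  have h := (sq_le_one_iff_abs_le_one _).2 (abs_symBias_le_one 0 0 π)
  rw [JOP_eq]
  linarith [sq_nonneg (symBias 0 1 π)]

theorem JOP_eq_half_iff (π : leverGame.Policy) : leverGame.JOP π = 1 / 2 ↔
    π ∈ leverGame.opClass policyR ∪ leverGame.opClass policyS := by
  rw [Set.mem_union, mem_opClass_policyR_iff, mem_opClass_policyS_iff, ← or_and_right,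
    ← sq_eq_one_iff, ← sq_eq_zero_iff (a := symBias 0 1 π), JOP_eq]
  have h := (sq_le_one_iff_abs_le_one _).2 (abs_symBias_le_one 0 0 π)
  have h' := sq_nonneg (symBias 0 1 π)
  constructor
  · intro hJ
    constructor <;> linarith
  · rintro ⟨h0, h1⟩
    linarith

theorem isOPOptimal_iff (π : leverGame.Policy) : leverGame.IsOPOptimal π ↔
    π ∈ leverGame.opClass policyR ∪ leverGame.opClass policyS := by
  rw [← JOP_eq_half_iff]
  constructor
  · intro h
    have JOP_policyR := (JOP_eq_half_iff policyR).2 (Or.inl rfl)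
    exact (JOP_le_half π).antisymm (JOP_policyR ▸ h policyR)
  · intro h π'
    exact (JOP_le_half π').trans_eq h.symm

/-! ### Learning both classes -/

section PushClass

variable {E : DecPOMDP} (f : Iso leverGame E)

theorem mem_pushClass_iff {ρ : E.Policy} {π : leverGame.Policy} : ρ ∈ f.pushClass π ↔
    symBias 0 0 ρ = symBias 0 0 π ∧ symBias 0 1 ρ = symBias 0 1 π := by
  obtain ⟨ρ, rfl⟩ := f.push_surjective ρ
  rw [Iso.pushClass, f.push_mem_opClass_push_iff hasIndependentMixtures_leverGame, mem_opClass_iff,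
    symBias_push, symBias_push]

theorem isOPOptimal_of_mem_pushClass {ρ : E.Policy}
    (hρ : ρ ∈ f.pushClass policyR ∪ f.pushClass policyS) : E.IsOPOptimal ρ := by
  obtain ⟨ρ, rfl⟩ := f.push_surjective ρ
  rw [f.isOPOptimal_push_iff, isOPOptimal_iff]
  simpa only [Set.mem_union, Iso.pushClass,
    f.push_mem_opClass_push_iff hasIndependentMixtures_leverGame] using hρ

theorem isClosed_pushClass (π : leverGame.Policy) : IsClosed (f.pushClass π) := by
  have pushClass_eq : f.pushClass π =
      {ρ | symBias 0 0 ρ = symBias 0 0 π} ∩ {ρ | symBias 0 1 ρ = symBias 0 1 π} :=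
    Set.ext fun _ => mem_pushClass_iff f
  rw [pushClass_eq]
  exact (isClosed_eq (continuous_symBias 0 0) continuous_const).inter
    (isClosed_eq (continuous_symBias 0 1) continuous_const)

variable {f} {μ : Measure E.Policy} [IsProbabilityMeasure μ] {π : leverGame.Policy}

theorem ae_mem_pushClass (hμ : μ (f.pushClass π) = 1) : ∀ᵐ ρ ∂μ, ρ ∈ f.pushClass π :=
  (mem_ae_iff_prob_eq_one (isClosed_pushClass f π).measurableSet).2 hμ

theorem integral_symBias_of_pushClass (hμ : μ (f.pushClass π) = 1) :
    ∫ ρ, symBias 0 0 ρ ∂μ = symBias 0 0 π := by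
  have ae_eq : (fun ρ => symBias 0 0 ρ) =ᵐ[μ] fun _ => symBias 0 0 π :=
    (ae_mem_pushClass hμ).mono fun ρ hρ => ((mem_pushClass_iff f).1 hρ).1
  rw [integral_congr_ae ae_eq, integral_const, probReal_univ, one_smul]

end PushClass

section LearnsBoth

variable {f : ∀ E : leverGame.relabelings, Iso leverGame (E : DecPOMDP)}
  {σ : LearningAlg leverGame.relabelings}

theorem isOPAlg_of_learnsBoth (hσ : leverGame.LearnsBoth policyR policyS f σ) : IsOPAlg σ := by
  obtain ⟨α, μ, μ', -, hmix, hμ, hμ', -⟩ := hσ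
  refine isOPAlg_of_ae_isOPOptimal fun E => ?_
  rw [hmix E, ae_add_measure_iff]
  exact ⟨Measure.ae_smul_measure ((ae_mem_pushClass (hμ E)).mono fun ρ hρ =>
      isOPOptimal_of_mem_pushClass (f E) (Or.inl hρ)) _,
    Measure.ae_smul_measure ((ae_mem_pushClass (hμ' E)).mono fun ρ hρ =>
      isOPOptimal_of_mem_pushClass (f E) (Or.inr hρ)) _⟩

theorem abs_learnedBias_lt_one (hσ : leverGame.LearnsBoth policyR policyS f σ) :
    |learnedBias σ 0 0| < 1 := by
  obtain ⟨α, μ, μ', hα, hmix, hμ, hμ', ⟨ER, hER⟩, ⟨ES, hES⟩⟩ := hσ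
  have integral_eq (E : leverGame.relabelings) :
      ∫ ρ, symBias 0 0 ρ ∂(σ E : Measure (Policy (E : DecPOMDP))) = 2 * α E - 1 := by
    have hint {ν : Measure (Policy (E : DecPOMDP))} [IsFiniteMeasure ν] (c : ℝ) :
        Integrable (symBias 0 0) (ENNReal.ofReal c • ν) :=
      (integrable_of_continuous (continuous_symBias 0 0)).smul_measure ENNReal.ofReal_ne_top
    have bias_R : symBias 0 0 policyR = 1 := symBias_policyR 0 0
    have bias_S : symBias 0 0 policyS = -1 := symBias_policyS 0 0
    rw [hmix E, integral_add_measure (hint _) (hint _), integral_smul_measure,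
      integral_smul_measure, integral_symBias_of_pushClass (hμ E),
      integral_symBias_of_pushClass (hμ' E), ENNReal.toReal_ofReal (hα E).1,
      ENNReal.toReal_ofReal (sub_nonneg.2 (hα E).2), bias_R, bias_S, smul_eq_mul, smul_eq_mul]
    ring
  simp only [learnedBias, integral_eq]
  refine abs_lt.2 ⟨?_, ?_⟩
  · refine Finset.lt_expect (fun E _ => ?_) ⟨ER, Finset.mem_univ ER, ?_⟩
    · linarith [(hα E).1]
    · linarith
  · refine Finset.expect_lt (fun E _ => ?_) ⟨ES, Finset.mem_univ ES, ?_⟩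
    · linarith [(hα E).2]
    · linarith

theorem lfcValue_lt_half_of_learnsBoth (hσ : leverGame.LearnsBoth policyR policyS f σ) :
    leverGame.lfcValue σ < 1 / 2 := by
  have h := (sq_lt_one_iff_abs_lt_one _).2 (abs_learnedBias_lt_one hσ)
  rw [lfcValue_eq]
  linarith [sq_nonneg (learnedBias σ 0 1)]

end LearnsBoth

theorem exists_lfcValue_eq_half
    (f : ∀ E : leverGame.relabelings, Iso leverGame (E : DecPOMDP)) :
    ∃ σ : LearningAlg leverGame.relabelings, leverGame.lfcValue σ = 1 / 2 := by
  refine ⟨fun E => diracProba ((f E).push policyR), ?_⟩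
  rw [lfcValue_eq]
  simp only [learnedBias, diracProba, ProbabilityMeasure.coe_mk,
    integral_dirac' _ _ (continuous_symBias _ _).stronglyMeasurable, symBias_push,
    Finset.expect_const Finset.univ_nonempty, symBias_policyR]
  simp [leverSign]

end LeverGame

theorem mainTheorem2 :
    -- the OP-optimal policies form exactly two classes, both of OP value `1/2`
    (leverGame.opClass policyR ≠ leverGame.opClass policyS ∧
      (∀ π : leverGame.Policy, leverGame.IsOPOptimal π ↔
        π ∈ leverGame.opClass policyR ∪ leverGame.opClass policyS) ∧
      (∀ π ∈ leverGame.opClass policyR ∪ leverGame.opClass policyS,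
        leverGame.JOP π = 1 / 2)) ∧
    -- cross-play values
    (leverGame.J (fun i => if i = 0 then policyR i else policyS i) = -1 / 2 ∧
      leverGame.J (fun i => if i = 0 then policyS i else policyR i) = -1 / 2) ∧
    -- learning both classes
    (∀ (f : ∀ E : leverGame.relabelings, DecPOMDP.Iso leverGame (E : DecPOMDP))
      (σ : DecPOMDP.LearningAlg leverGame.relabelings),
      leverGame.LearnsBoth policyR policyS f σ →
        DecPOMDP.IsOPAlg σ ∧ leverGame.lfcValue σ < 1 / 2 ∧ ¬ leverGame.IsLFCOptimal σ) := by
  refine ⟨⟨LeverGame.opClass_policyR_ne_opClass_policyS, LeverGame.isOPOptimal_iff,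
      fun π hπ => (LeverGame.JOP_eq_half_iff π).2 hπ⟩,
    ⟨LeverGame.J_policyR_policyS, LeverGame.J_policyS_policyR⟩, fun f σ hσ => ?_⟩
  have value_lt_half := LeverGame.lfcValue_lt_half_of_learnsBoth hσ
  refine ⟨LeverGame.isOPAlg_of_learnsBoth hσ, value_lt_half, fun hopt => ?_⟩
  obtain ⟨σ', value_eq_half⟩ := LeverGame.exists_lfcValue_eq_half f
  exact ((hopt σ').trans_lt value_lt_half).ne value_eq_half
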